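/- Let $H$ be a complex Hilbert space with inner product $\langle\cdot,\cdot\rangle$, antilinear in the first and linear in the second variable, and let $x\mapsto\bar x$ be a self-adjoint involution of $H$, i.e. a linear map with $\langle\bar x,y\rangle=\langle x,\bar y\rangle$ and $\bar{\bar x}=x$. Let $\alpha,q\in(-1,1)$. Let $\Sigma(n)$ be the group of bijections $\sigma$ of $\{\pm1,\dots,\pm n\}$ with $\sigma(-k)=-\sigma(k)$, generated by $\pi_0=(1,-1)$ and $\pi_i=(i,i+1)$ (acting also as $(-i,-(i+1))$), $1\le i\le n-1$. For $\sigma\in\Sigma(n)$ let $l_1(\sigma)$ be the number of factors $\pi_0$, and $l_2(\sigma)$ the number of factors $\pi_i$ with $i\ge1$, in an expression of $\sigma$ as a product of generators of minimal length (these numbers do not depend on the expression). The group $\Sigma(n)$ acts linearly on the algebraic tensor power $H^{\otimes n}$, where $\pi_0(x_1\otimes\cdots\otimes x_n)=\overline{x_1}\otimes x_2\otimes\cdots\otimes x_n$ and $\pi_i$, $i\ge1$, interchanges the factors $i$ and $i+1$. Let $\mathcal F=\bigoplus_{n\ge0}H^{\otimes n}$ be the algebraic full Fock space (finite sums, no completion;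 $H^{\otimes0}=\mathbb C\Omega$), let $\langle\cdot,\cdot\rangle_{0,0}$ be the form on $\mathcal F$ with $\langle x_1\otimes\cdots\otimes x_m,y_1\otimes\cdots\otimes y_n\rangle_{0,0}=\delta_{m,n}\prod_{i=1}^n\langle x_i,y_i\rangle$, and put, with $0^0=1$, $$P^{(n)}_{\alpha,q}=\sum_{\sigma\in\Sigma(n)}\alpha^{l_1(\sigma)}q^{l_2(\sigma)}\,\sigma,\qquad \langle f,g\rangle_{\alpha,q}=\sum_{n\ge0}\langle f_n,P^{(n)}_{\alpha,q}g_n\rangle_{0,0},$$ where $f_n,g_n$ are the components of $f,g\in\mathcal F$ in $H^{\otimes n}$. For $x\in H$ let $b^*(x)$ be the linear operator on $\mathcal F$ with $b^*(x)(x_1\otimes\cdots\otimes x_n)=x_1\otimes\cdots\otimes x_n\otimes x$ and $b^*(x)\Omega=x$. Then for every $x\in H$ the operator $b^*(x)$ has exactly one adjoint with respect to $\langle\cdot,\cdot\rangle_{\alpha,q}$, i.e. there is exactly one linear operator $b(x)$ on $\mathcal F$ with $\langle b^*(x)f,g\rangle_{\alpha,q}=\langle f,b(x)g\rangle_{\alpha,q}$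 for all $f,g\in\mathcal F$; and for all $x,y\in H$ $$b(x)b^*(y)-q\,b^*(y)b(x)=\langle x,y\rangle\,I+\alpha\,\langle x,\bar y\rangle\,q^{2N},$$ where $N$ is the number operator, $Nf=nf$ for $f\in H^{\otimes n}$, so that $q^{2N}f=q^{2n}f$ for $f\in H^{\otimes n}$. -/

import Mathlib

open scoped TensorProduct DirectSum

noncomputable section

namespace TypeBFock

/-! ### The Coxeter group of type B -/

/-- The map `k ↦ -k` on the `2n` points `±1, …, ±n`; the point `s · (k + 1)`, with `s = ±1`, is
represented by the pair `(k, s)` in `Fin n × ℤˣ`. -/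
def opp {n : ℕ} (p : Fin n × ℤˣ) : Fin n × ℤˣ := (p.1, -p.2)

/-- The hyperoctahedral group `Σ(n)`: all bijections `σ` of `{±1, …, ±n}` with
`σ (-k) = -σ k`, under composition. -/
def hyperoctahedral (n : ℕ) : Subgroup (Equiv.Perm (Fin n × ℤˣ)) where
  carrier := {σ | ∀ p, σ (opp p) = opp (σ p)}
  one_mem' := fun _ => rfl
  mul_mem' := by
    intro σ τ hσ hτ p
    change ∀ p, σ (opp p) = opp (σ p) at hσ
    change ∀ p, τ (opp p) = opp (τ p) at hτ
    simp only [Equiv.Perm.mul_apply, hτ, hσ]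
  inv_mem' := by
    intro σ hσ p
    change ∀ p, σ (opp p) = opp (σ p) at hσ
    rw [Equiv.Perm.inv_eq_iff_eq, hσ]
    exact congrArg opp (σ.apply_symm_apply p).symm

instance hyperoctahedralFintype (n : ℕ) : Fintype (hyperoctahedral n) := Fintype.ofFinite _

theorem swap_sign_mem {n : ℕ} (i : Fin n) :
    Equiv.swap ((i, 1) : Fin n × ℤˣ) (i, -1) ∈ hyperoctahedral n := by
  rintro ⟨k, s⟩
  rcases Int.units_eq_one_or s with rfl | rfl <;>
    by_cases h : k = i <;> simp [opp, Equiv.swap_apply_def, h]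

theorem perm_mem {n : ℕ} (e : Equiv.Perm (Fin n)) :
    e.prodCongr (Equiv.refl ℤˣ) ∈ hyperoctahedral n := fun _ => rfl

/-- The Coxeter generators: `gen 0` is `π₀ = (1, -1)`, and `gen i` with `1 ≤ i ≤ n - 1` is
`πᵢ = (i, i + 1)` (together with `(-i, -(i + 1))`), that is, the transposition of the positions
`i - 1` and `i` when positions are counted from `0`. -/
def gen {n : ℕ} (i : Fin n) : hyperoctahedral n :=
  if i.val = 0 then ⟨Equiv.swap (i, 1) (i, -1), swap_sign_mem i⟩
  else ⟨(Equiv.swap (⟨i.val - 1, by omega⟩ : Fin n) i).prodCongr (Equiv.refl ℤˣ), perm_mem _⟩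

/-- `w` is an irreducible form of `σ`: an expression of `σ` as a product of generators of minimal
length. -/
def IsIrreducibleForm {n : ℕ} (w : List (Fin n)) (σ : hyperoctahedral n) : Prop :=
  (w.map gen).prod = σ ∧ ∀ w' : List (Fin n), (w'.map gen).prod = σ → w.length ≤ w'.length

/-- `l₁(σ)`: the number of letters `π₀` in an irreducible form of `σ`. (This number is the same for
all irreducible forms, so the infimum is over a one-element set.) -/
def l₁ {n : ℕ} (σ : hyperoctahedral n) : ℕ :=
  sInf {m | ∃ w : List (Fin n), IsIrreducibleForm w σ ∧ m = w.countP (fun i => i.val = 0)}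

/-- `l₂(σ)`: the number of letters `πᵢ`, `1 ≤ i ≤ n - 1`, in an irreducible form of `σ`. (This
number is the same for all irreducible forms, so the infimum is over a one-element set.) -/
def l₂ {n : ℕ} (σ : hyperoctahedral n) : ℕ :=
  sInf {m | ∃ w : List (Fin n), IsIrreducibleForm w σ ∧ m = w.countP (fun i => i.val ≠ 0)}

/-! ### The action on tensor powers -/

/-- The permutation `k ↦ |σ(k)|` of the `n` positions. -/
def absPerm {n : ℕ} (σ : hyperoctahedral n) : Equiv.Perm (Fin n) where
  toFun k := (σ.1 (k, 1)).1
  invFun k := (σ.1⁻¹ (k, 1)).1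
  left_inv k := by
    have h := (hyperoctahedral n).inv_mem σ.2
    have h1 : ∀ p, (σ.1⁻¹ (p.1, 1)).1 = (σ.1⁻¹ p).1 := by
      rintro ⟨k, s⟩
      rcases Int.units_eq_one_or s with rfl | rfl
      · rfl
      · exact (congrArg Prod.fst (h (k, 1))).symm
    refine (h1 _).trans ?_
    exact congrArg Prod.fst (σ.1.symm_apply_apply (k, 1))
  right_inv k := by
    have h1 : ∀ p, (σ.1 (p.1, 1)).1 = (σ.1 p).1 := by
      rintro ⟨k, s⟩
      rcases Int.units_eq_one_or s with rfl | rfl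
      · rfl
      · exact (congrArg Prod.fst (σ.2 (k, 1))).symm
    refine (h1 _).trans ?_
    exact congrArg Prod.fst (σ.1.apply_symm_apply (k, 1))

variable {H : Type*} [NormedAddCommGroup H] [InnerProductSpace ℂ H]

/-- The action of `σ ∈ Σ(n)` on the algebraic tensor power `H^{⊗n}`, where `J x = x̄`. With the
convention `x₋ₖ = x̄ₖ`, it sends `x₁ ⊗ ⋯ ⊗ xₙ` to the tensor whose `k`-th factor is `x_{σ⁻¹(k)}`. -/
def act (J : H →ₗ[ℂ] H) {n : ℕ} (σ : hyperoctahedral n) : (⨂[ℂ]^n H) →ₗ[ℂ] (⨂[ℂ]^n H) :=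
  PiTensorProduct.map (fun k => if (σ.1⁻¹ (k, 1)).2 = 1 then LinearMap.id else J) ∘ₗ
    (PiTensorProduct.reindex ℂ (fun _ : Fin n => H) (absPerm σ)).toLinearMap

theorem act_tprod (J : H →ₗ[ℂ] H) {n : ℕ} (σ : hyperoctahedral n) (x : Fin n → H) :
    act J σ (PiTensorProduct.tprod ℂ x) = PiTensorProduct.tprod ℂ (fun k =>
      if (σ.1⁻¹ (k, 1)).2 = 1 then x (σ.1⁻¹ (k, 1)).1 else J (x (σ.1⁻¹ (k, 1)).1)) := by
  simp only [act, LinearMap.comp_apply, LinearEquiv.coe_coe, PiTensorProduct.reindex_tprod,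
    PiTensorProduct.map_tprod]
  congr 1
  funext k
  split_ifs <;> rfl

theorem act_one (J : H →ₗ[ℂ] H) {n : ℕ} :
    act J (1 : hyperoctahedral n) = LinearMap.id := by
  refine PiTensorProduct.ext (MultilinearMap.ext fun x => ?_)
  simp [act_tprod]

theorem act_mul (J : H →ₗ[ℂ] H) (hJ : ∀ x, J (J x) = x) {n : ℕ} (σ τ : hyperoctahedral n) :
    act J (σ * τ) = act J σ ∘ₗ act J τ := by
  refine PiTensorProduct.ext (MultilinearMap.ext fun x => ?_)
  simp only [LinearMap.compMultilinearMap_apply, LinearMap.comp_apply, act_tprod]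
  congr 1
  funext k
  have hτ := (hyperoctahedral n).inv_mem τ.2
  have e : ((σ * τ : hyperoctahedral n).1)⁻¹ (k, 1) = τ.1⁻¹ (σ.1⁻¹ (k, 1)) := by
    simp [mul_inv_rev]
  rw [e]
  obtain ⟨j, s⟩ := σ.1⁻¹ (k, 1)
  rcases Int.units_eq_one_or s with rfl | rfl
  · simp
  · have h : τ.1⁻¹ (j, -1) = opp (τ.1⁻¹ (j, 1)) := hτ (j, 1)
    rw [h]
    obtain ⟨i, t⟩ := τ.1⁻¹ (j, 1)
    rcases Int.units_eq_one_or t with rfl | rfl <;> simp [opp, hJ]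

/-- `π₀` sends `x₁ ⊗ x₂ ⊗ ⋯ ⊗ xₙ` to `x̄₁ ⊗ x₂ ⊗ ⋯ ⊗ xₙ`. -/
theorem act_gen_zero (J : H →ₗ[ℂ] H) {n : ℕ} (i : Fin n) (hi : i.val = 0) (x : Fin n → H) :
    act J (gen i) (PiTensorProduct.tprod ℂ x) =
      PiTensorProduct.tprod ℂ (Function.update x i (J (x i))) := by
  rw [act_tprod]
  congr 1
  funext k
  by_cases h : k = i
  · subst h
    simp [gen, hi]
  · simp [gen, hi, h, Equiv.swap_apply_def]

/-- `πᵢ` with `i ≥ 1` interchanges two neighbouring factors. -/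
theorem act_gen_pos (J : H →ₗ[ℂ] H) {n : ℕ} (i : Fin n) (hi : i.val ≠ 0) (x : Fin n → H) :
    act J (gen i) (PiTensorProduct.tprod ℂ x) =
      PiTensorProduct.tprod ℂ
        (fun k => x (Equiv.swap (⟨i.val - 1, by omega⟩ : Fin n) i k)) := by
  rw [act_tprod]
  congr 1
  funext k
  have e : (gen i).1⁻¹ (k, 1) = (Equiv.swap (⟨i.val - 1, by omega⟩ : Fin n) i k, 1) := by
    rw [Equiv.Perm.inv_eq_iff_eq]
    simp [gen, hi]
  simp [e]

/-! ### The Fock space and its inner products -/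

/-- The algebraic full Fock space `⨁ₙ H^{⊗n}` (algebraic tensor powers, finite sums). -/
abbrev Fock (H : Type*) [NormedAddCommGroup H] [InnerProductSpace ℂ H] : Type _ :=
  ⨁ n : ℕ, ⨂[ℂ]^n H

/-- The multilinear map `y ↦ ∏ᵢ ⟨xᵢ, yᵢ⟩`. -/
def prodInner {n : ℕ} (x : Fin n → H) : MultilinearMap ℂ (fun _ : Fin n => H) ℂ :=
  (MultilinearMap.mkPiAlgebra ℂ (Fin n) ℂ).compLinearMap (fun i => (innerSL ℂ (x i)).toLinearMap)

theorem prodInner_apply {n : ℕ} (x y : Fin n → H) :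
    prodInner x y = ∏ i, inner ℂ (x i) (y i) := by
  simp [prodInner]

/-- For fixed `y`, the antilinear functional `s ↦ ⟨s, y₁ ⊗ ⋯ ⊗ yₙ⟩`, the complex conjugate of
`s ↦ ⟨y₁ ⊗ ⋯ ⊗ yₙ, s⟩`. -/
def innerTensorAux {n : ℕ} (y : Fin n → H) : (⨂[ℂ]^n H) →ₗ⋆[ℂ] ℂ :=
  (starLinearEquiv ℂ (A := ℂ)).toLinearMap.comp (PiTensorProduct.lift (prodInner y))

theorem innerTensorAux_tprod {n : ℕ} (y x : Fin n → H) :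
    innerTensorAux y (PiTensorProduct.tprod ℂ x) = prodInner x y := by
  simp [innerTensorAux, prodInner_apply]

theorem antilinear_ext {n : ℕ} {f g : (⨂[ℂ]^n H) →ₗ⋆[ℂ] ℂ}
    (h : ∀ x : Fin n → H, f (PiTensorProduct.tprod ℂ x) = g (PiTensorProduct.tprod ℂ x)) :
    f = g := by
  refine LinearMap.ext fun s => ?_
  induction s using PiTensorProduct.induction_on with
  | smul_tprod r x => rw [map_smulₛₗ, map_smulₛₗ, h]
  | add s t hs ht => rw [map_add, map_add, hs, ht]

/-- The sesquilinear form on `H^{⊗n}`, antilinear in the first variable, with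
`⟨x₁ ⊗ ⋯ ⊗ xₙ, y₁ ⊗ ⋯ ⊗ yₙ⟩ = ∏ᵢ ⟨xᵢ, yᵢ⟩`. -/
def innerTensor (n : ℕ) : (⨂[ℂ]^n H) →ₗ⋆[ℂ] (⨂[ℂ]^n H) →ₗ[ℂ] ℂ :=
  LinearMap.flip (PiTensorProduct.lift
    { toFun := fun y : Fin n → H => innerTensorAux y
      map_update_add' := fun y i a b => antilinear_ext fun x => by
        simp only [LinearMap.add_apply, innerTensorAux_tprod, MultilinearMap.map_update_add]
      map_update_smul' := fun y i c a => antilinear_ext fun x => by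
        simp only [LinearMap.smul_apply, innerTensorAux_tprod, MultilinearMap.map_update_smul] })

theorem innerTensor_tprod {n : ℕ} (x y : Fin n → H) :
    innerTensor n (PiTensorProduct.tprod ℂ x) (PiTensorProduct.tprod ℂ y) =
      ∏ i, inner ℂ (x i) (y i) := by
  simp [innerTensor, LinearMap.flip_apply, innerTensorAux_tprod, prodInner_apply]

/-- The type B symmetrization operator
`P^{(n)}_{α,q} = ∑_{σ ∈ Σ(n)} α^{l₁(σ)} q^{l₂(σ)} σ` on `H^{⊗n}` (it is the identity for
`n = 0`). -/
def symmetrization (α q : ℝ) (J : H →ₗ[ℂ] H) (n : ℕ) : (⨂[ℂ]^n H) →ₗ[ℂ] (⨂[ℂ]^n H) :=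
  ∑ σ : hyperoctahedral n, ((α : ℂ) ^ l₁ σ * (q : ℂ) ^ l₂ σ) • act J σ

/-- The deformed inner product `⟨f, g⟩_{α,q} = ∑ₙ ⟨fₙ, P^{(n)}_{α,q} gₙ⟩_{0,0}` on the Fock
space. -/
def innerFock (α q : ℝ) (J : H →ₗ[ℂ] H) (f g : Fock H) : ℂ :=
  DirectSum.toModule ℂ ℕ ℂ (fun n => innerTensor n (f n) ∘ₗ symmetrization α q J n) g

/-! ### Creation, annihilation and number operators -/

/-- The map `x₁ ⊗ ⋯ ⊗ xₙ ↦ x₁ ⊗ ⋯ ⊗ xₙ ⊗ x` from `H^{⊗n}` to `H^{⊗(n+1)}`. -/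
def appendRight (x : H) (n : ℕ) : (⨂[ℂ]^n H) →ₗ[ℂ] (⨂[ℂ]^(n + 1) H) :=
  (PiTensorProduct.lift
    (MultilinearMap.curryRight (PiTensorProduct.tprod ℂ (s := fun _ : Fin (n + 1) => H)))).flip x

theorem appendRight_tprod (x : H) (n : ℕ) (v : Fin n → H) :
    appendRight x n (PiTensorProduct.tprod ℂ v) =
      PiTensorProduct.tprod ℂ (Fin.snoc (α := fun _ => H) v x) := by
  simp [appendRight, LinearMap.flip_apply]

/-- The creation operator `b*(x)`: on every `H^{⊗n}` it appends `x` on the right. -/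
def creation (x : H) : Fock H →ₗ[ℂ] Fock H :=
  DirectSum.toModule ℂ ℕ (Fock H) fun n =>
    DirectSum.lof ℂ ℕ (fun m : ℕ => ⨂[ℂ]^m H) (n + 1) ∘ₗ appendRight x n

/-- `b` is the annihilation operator `b(x)`: an adjoint of `b*(x)` with respect to
`⟨·,·⟩_{α,q}`. -/
def IsAnnihilation (α q : ℝ) (J : H →ₗ[ℂ] H) (x : H) (b : Fock H →ₗ[ℂ] Fock H) : Prop :=
  ∀ f g : Fock H, innerFock α q J (creation x f) g = innerFock α q J f (b g)

/-- The function `φ(N)` of the number operator `N`: multiplication by `φ n` on `H^{⊗n}`. In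
particular `N` itself is the case `φ n = n`. -/
def functionOfNumber (φ : ℕ → ℂ) : Fock H →ₗ[ℂ] Fock H :=
  DirectSum.lmap fun n => φ n • (LinearMap.id : (⨂[ℂ]^n H) →ₗ[ℂ] (⨂[ℂ]^n H))

/-- The operator `q^{2N}`, with `q^{2N} f = q^{2n} f` for `f ∈ H^{⊗n}` (and `0⁰ = 1`). -/
def qPowTwoN (q : ℝ) : Fock H →ₗ[ℂ] Fock H := functionOfNumber fun n => (q : ℂ) ^ (2 * n)

end TypeBFock

end

/-!
The symmetrizer factors over the right cosets of `Σ(n)` in `Σ(n + 1)` as `P⁽ⁿ⁺¹⁾ = (P⁽ⁿ⁾ ⊗ 1) Bₙ`,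
where `Bₙ` is the weighted sum over the minimal coset representatives. Hence "let `Bₙ` act, then
contract the last factor with `x`" is an adjoint of `b*(x)`. Writing out the representatives gives
`Bₙ₊₁ = 1 + q πₙ₊₁ (Bₙ ⊗ 1) + α q²ⁿ⁺² τ`, where `τ` is the change of sign of the last point, and
contracting this identity yields the commutation relation.

Uniqueness of the adjoint is nondegeneracy of the form, that is, invertibility of every `Bₙ`. If
`S` and `S'` are the symmetrizers of the symmetric groups on `n` and `n + 1` letters, the braid
relations give `S Bₙ = (1 + α qⁿ g) S'` with a group element `g`. Zagier's telescoping identity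
writes `S` and `S'` in the same way through factors `1 - c g`, where `|c| < 1` and `g` is a
group element. Since `g` has finite order, these factors are invertible, and no positivity of
the form is needed.
-/

noncomputable section

namespace TypeBFock

/-! ### Sums over words in a braided sequence -/

section Braid

section Monoid

variable {M N : Type*} [Monoid M] [Monoid N]

/-- The descending product `s (m - 1) * ⋯ * s 1 * s 0`. For the adjacent transpositions it is a
cycle of length `m + 1`. -/
def descProd (s : ℕ → M) : ℕ → M
  | 0 => 1
  | m + 1 => s m * descProd s m

/-- The ascending product `s 0 * s 1 * ⋯ * s (m - 1)`. -/
def ascProd (s : ℕ → M) : ℕ → M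
  | 0 => 1
  | m + 1 => ascProd s m * s m

theorem descProd_succ' (s : ℕ → M) (m : ℕ) :
    descProd s (m + 1) = descProd (fun i => s (i + 1)) m * s 0 := by
  induction m with
  | zero => simp only [descProd, mul_one, one_mul]
  | succ m ih => rw [descProd, ih, ← mul_assoc, descProd]

/-- The first `N` terms of the sequence `s` satisfy the relations of the standard generators of the
braid group on `N + 1` strands. No quadratic relation is imposed. -/
structure IsBraid (s : ℕ → M) (N : ℕ) : Prop where
  comm : ∀ i j, i + 1 < j → j < N → Commute (s i) (s j)
  braid : ∀ i, i + 1 < N → s i * s (i + 1) * s i = s (i + 1) * s i * s (i + 1)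

theorem IsBraid.mono {s : ℕ → M} {m n : ℕ} (h : IsBraid s n) (hmn : m ≤ n) : IsBraid s m where
  comm i j hij hj := h.comm i j hij (hj.trans_le hmn)
  braid i hi := h.braid i (hi.trans_le hmn)

theorem IsBraid.shift {s : ℕ → M} {m : ℕ} (h : IsBraid s (m + 1)) :
    IsBraid (fun i => s (i + 1)) m where
  comm i j hij hj := h.comm (i + 1) (j + 1) (by omega) (by omega)
  braid i hi := h.braid (i + 1) (by omega)

theorem IsBraid.map {F : Type*} [FunLike F M N] [MonoidHomClass F M N] {s : ℕ → M} {m : ℕ}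
    (h : IsBraid s m) (φ : F) : IsBraid (fun i => φ (s i)) m where
  comm i j hij hj := (h.comm i j hij hj).map φ
  braid i hi := by simp only [← map_mul, h.braid i hi]

theorem map_descProd {F : Type*} [FunLike F M N] [MonoidHomClass F M N] (φ : F) {s : ℕ → M}
    {s' : ℕ → N} {m : ℕ} (h : ∀ i < m, φ (s i) = s' i) : φ (descProd s m) = descProd s' m := by
  induction m with
  | zero => exact map_one φ
  | succ m ih =>
    rw [descProd, descProd, map_mul, h m m.lt_succ_self,
      ih fun i hi => h i (hi.trans m.lt_succ_self)]

theorem map_ascProd {F : Type*} [FunLike F M N] [MonoidHomClass F M N] (φ : F) {s : ℕ → M}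
    {s' : ℕ → N} {m : ℕ} (h : ∀ i < m, φ (s i) = s' i) : φ (ascProd s m) = ascProd s' m := by
  induction m with
  | zero => exact map_one φ
  | succ m ih =>
    rw [ascProd, ascProd, map_mul, h m m.lt_succ_self,
      ih fun i hi => h i (hi.trans m.lt_succ_self)]

theorem descProd_mem {S : Submonoid M} {s : ℕ → M} (h : ∀ i, s i ∈ S) (m : ℕ) :
    descProd s m ∈ S := by
  induction m with
  | zero => exact one_mem S
  | succ m ih => exact mul_mem (h m) ih

theorem commute_descProd {s : ℕ → M} {g : M} {m : ℕ} (h : ∀ i < m, Commute (s i) g) :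
    Commute (descProd s m) g := by
  induction m with
  | zero => exact Commute.one_left g
  | succ m ih =>
    exact (h m m.lt_succ_self).mul_left (ih fun i hi => h i (hi.trans m.lt_succ_self))

theorem commute_ascProd {s : ℕ → M} {g : M} {m : ℕ} (h : ∀ i < m, Commute (s i) g) :
    Commute (ascProd s m) g := by
  induction m with
  | zero => exact Commute.one_left g
  | succ m ih =>
    exact (ih fun i hi => h i (hi.trans m.lt_succ_self)).mul_left (h m m.lt_succ_self)

theorem IsBraid.semiconjBy_descProd {s : ℕ → M} {m i : ℕ} (h : IsBraid s m) (hi : i + 1 < m) :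
    SemiconjBy (descProd s m) (s (i + 1)) (s i) := by
  induction m with
  | zero => omega
  | succ m ih =>
    rcases Nat.lt_or_ge (i + 1) m with him | him
    · exact SemiconjBy.mul_left (h.comm i m him m.lt_succ_self).symm (ih (h.mono m.le_succ) him)
    · obtain rfl : m = i + 1 := by omega
      have hpair : SemiconjBy (s (i + 1) * s i) (s (i + 1)) (s i) := by
        rw [SemiconjBy, ← h.braid i hi, mul_assoc]
      have hcomm : Commute (descProd s i) (s (i + 1)) :=
        commute_descProd fun j hj => h.comm j (i + 1) (by omega) (by omega)
      rw [descProd, descProd, ← mul_assoc]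
      exact hpair.mul_left hcomm

theorem IsBraid.semiconjBy_ascProd {s : ℕ → M} {m i : ℕ} (h : IsBraid s m) (hi : i + 1 < m) :
    SemiconjBy (ascProd s m) (s i) (s (i + 1)) := by
  induction m with
  | zero => omega
  | succ m ih =>
    rcases Nat.lt_or_ge (i + 1) m with him | him
    · exact (ih (h.mono m.le_succ) him).mul_left (h.comm i m him m.lt_succ_self).symm
    · obtain rfl : m = i + 1 := by omega
      have hpair : SemiconjBy (s i * s (i + 1)) (s i) (s (i + 1)) := by
        rw [SemiconjBy, h.braid i hi, mul_assoc]
      have hcomm : Commute (ascProd s i) (s (i + 1)) :=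
        commute_ascProd fun j hj => h.comm j (i + 1) (by omega) (by omega)
      rw [ascProd, ascProd, mul_assoc]
      exact SemiconjBy.mul_left hcomm hpair

end Monoid

section Algebra

variable {R A B : Type*} [CommRing R] [Ring A] [Algebra R A] [Ring B] [Algebra R B]

/-- The sum of `q ^ k • (s (m - 1) * ⋯ * s (m - k))` over `0 ≤ k ≤ m`: the weighted sum over the
minimal right coset representatives of the symmetric group on `m` letters in the one on `m + 1`. The
summation index is `b = m - k`. -/
def descSum (q : R) (s : ℕ → A) (m : ℕ) : A :=
  ∑ b ∈ Finset.range (m + 1), q ^ (m - b) • descProd (fun i => s (b + i)) (m - b)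

/-- The sum of `q ^ k • (s 0 * ⋯ * s (k - 1))` over `0 ≤ k ≤ m`. -/
def ascSum (q : R) (s : ℕ → A) (m : ℕ) : A :=
  ∑ k ∈ Finset.range (m + 1), q ^ k • ascProd s k

/-- The type A symmetrizer of the symmetric group on `m + 1` letters, written as the product
`descSum q s 1 * ⋯ * descSum q s m` given by its coset factorization. -/
def braidSymmetrizer (q : R) (s : ℕ → A) : ℕ → A
  | 0 => 1
  | m + 1 => braidSymmetrizer q s m * descSum q s (m + 1)

/-- The weighted sum over the minimal right coset representatives of `Σ(m)` in `Σ(m + 1)`, where `z`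
plays the role of `π₀` and `s i` that of `πᵢ₊₁`. The representatives without the letter `π₀` make up
`descSum`; the other ones are `s (m - 1) ⋯ s 0 z s 0 ⋯ s (k - 1)`. -/
def cosetSum (α q : R) (z : A) (s : ℕ → A) (m : ℕ) : A :=
  descSum q s m + (α * q ^ m) • (descProd s m * z * ascSum q s m)

theorem descSum_zero (q : R) (s : ℕ → A) : descSum q s 0 = 1 := by
  simp [descSum, descProd]

theorem ascSum_zero (q : R) (s : ℕ → A) : ascSum q s 0 = 1 := by
  simp [ascSum, ascProd]

theorem descSum_succ (q : R) (s : ℕ → A) (m : ℕ) :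
    descSum q s (m + 1) = 1 + q • (s m * descSum q s m) := by
  rw [descSum, Finset.sum_range_succ, Nat.sub_self, pow_zero, one_smul, descProd, add_comm, descSum,
    Finset.mul_sum, Finset.smul_sum]
  refine congrArg (1 + ·) (Finset.sum_congr rfl fun b hb => ?_)
  have hbm : b ≤ m := Nat.lt_succ_iff.1 (Finset.mem_range.1 hb)
  rw [Nat.succ_sub hbm, descProd, Nat.add_sub_cancel' hbm, pow_succ', mul_smul, mul_smul_comm]

theorem descSum_succ' (q : R) (s : ℕ → A) (m : ℕ) :
    descSum q s (m + 1) =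
      descSum q (fun i => s (i + 1)) m + q ^ (m + 1) • descProd s (m + 1) := by
  rw [descSum, Finset.sum_range_succ']
  simp only [descSum, Nat.add_sub_add_right, Nat.sub_zero, Nat.zero_add, Nat.add_right_comm]

theorem ascSum_succ (q : R) (s : ℕ → A) (m : ℕ) :
    ascSum q s (m + 1) = ascSum q s m + q ^ (m + 1) • ascProd s (m + 1) :=
  Finset.sum_range_succ _ _

theorem cosetSum_succ (α q : R) (z : A) (s : ℕ → A) (m : ℕ) :
    cosetSum α q z s (m + 1) = 1 + q • (s m * cosetSum α q z s m) +
      (α * q ^ (2 * (m + 1))) • (descProd s (m + 1) * z * ascProd s (m + 1)) := by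
  simp only [cosetSum, descSum_succ, ascSum_succ, descProd, mul_add, smul_add, mul_smul_comm,
    smul_smul, mul_assoc, add_assoc]
  congr 4 <;> ring

theorem map_descSum (φ : A →ₐ[R] B) (q : R) {s : ℕ → A} {s' : ℕ → B} {m : ℕ}
    (h : ∀ i < m, φ (s i) = s' i) : φ (descSum q s m) = descSum q s' m := by
  rw [descSum, map_sum, descSum]
  refine Finset.sum_congr rfl fun b _ => ?_
  rw [map_smul, map_descProd φ fun i hi => h (b + i) (by omega)]

theorem map_ascSum (φ : A →ₐ[R] B) (q : R) {s : ℕ → A} {s' : ℕ → B} {m : ℕ}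
    (h : ∀ i < m, φ (s i) = s' i) : φ (ascSum q s m) = ascSum q s' m := by
  rw [ascSum, map_sum, ascSum]
  refine Finset.sum_congr rfl fun k hk => ?_
  have hkm := Finset.mem_range.1 hk
  rw [map_smul, map_ascProd φ fun i hi => h i (by omega)]

theorem map_cosetSum (φ : A →ₐ[R] B) (α q : R) (z : A) {s : ℕ → A} {s' : ℕ → B} {m : ℕ}
    (h : ∀ i < m, φ (s i) = s' i) : φ (cosetSum α q z s m) = cosetSum α q (φ z) s' m := by
  simp only [cosetSum, map_add, map_smul, map_mul, map_descSum φ q h, map_descProd φ h,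
    map_ascSum φ q h]

theorem commute_ascSum (q : R) {s : ℕ → A} {g : A} {m : ℕ} (h : ∀ i < m, Commute (s i) g) :
    Commute (ascSum q s m) g :=
  Commute.sum_left _ _ _ fun k hk => by
    have hkm := Finset.mem_range.1 hk
    exact (commute_ascProd fun i hi => h i (by omega)).smul_left _

theorem semiconjBy_descSum (q : R) {s s' : ℕ → A} {g : A} {m : ℕ}
    (h : ∀ i < m, SemiconjBy g (s i) (s' i)) :
    SemiconjBy g (descSum q s m) (descSum q s' m) := by
  induction m with
  | zero => simpa only [descSum_zero] using SemiconjBy.one_right g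
  | succ m ih =>
    have hmul := (h m m.lt_succ_self).mul_right (ih fun i hi => h i (hi.trans m.lt_succ_self))
    rw [descSum_succ, descSum_succ]
    refine (SemiconjBy.one_right g).add_right ?_
    rw [SemiconjBy, mul_smul_comm, hmul.eq, smul_mul_assoc]

theorem semiconjBy_braidSymmetrizer (q : R) {s s' : ℕ → A} {g : A} {m : ℕ}
    (h : ∀ i < m, SemiconjBy g (s i) (s' i)) :
    SemiconjBy g (braidSymmetrizer q s m) (braidSymmetrizer q s' m) := by
  induction m with
  | zero => exact SemiconjBy.one_right g
  | succ m ih =>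
    exact (ih fun i hi => h i (hi.trans m.lt_succ_self)).mul_right (semiconjBy_descSum q h)

/-- Zagier's telescoping identity: it reduces the invertibility of `descSum` to that of elements
`1 - c • g` with `g` a group element. -/
theorem IsBraid.descSum_mul_one_sub (q : R) {s : ℕ → A} {m : ℕ} (h : IsBraid s (m + 1)) :
    descSum q s (m + 1) * (1 - q ^ (m + 1) • descProd s (m + 1)) =
      (1 - q ^ (m + 2) • (s m * descProd s (m + 1))) * descSum q (fun i => s (i + 1)) m := by
  have hpush : descSum q s (m + 1) * descProd s (m + 1) = descProd s (m + 1) +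
      q • (s m * descProd s (m + 1) * descSum q (fun i => s (i + 1)) m) := by
    have hconj : SemiconjBy (descProd s (m + 1)) (descSum q (fun i => s (i + 1)) m)
        (descSum q s m) :=
      semiconjBy_descSum q fun i hi => h.semiconjBy_descProd (by omega)
    rw [descSum_succ, add_mul, one_mul, smul_mul_assoc, mul_assoc, mul_assoc, hconj.eq]
  rw [mul_sub, mul_one, mul_smul_comm, hpush, descSum_succ', sub_mul, one_mul, smul_mul_assoc,
    smul_add, smul_smul, ← pow_succ]
  abel

theorem IsBraid.descSum_shift_mul_ascSum (q : R) {s : ℕ → A} {m : ℕ} (h : IsBraid s (m + 1)) :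
    descSum q (fun i => s (i + 1)) m * ascSum q s (m + 1) =
      ascSum q s m * descSum q s (m + 1) := by
  induction m with
  | zero => simp [descSum_succ, descSum_zero, ascSum_succ, ascSum_zero, ascProd]
  | succ m ih =>
    have hconj : SemiconjBy (ascProd s (m + 2)) (descSum q s (m + 1))
        (descSum q (fun i => s (i + 1)) (m + 1)) :=
      semiconjBy_descSum q fun i hi => h.semiconjBy_ascProd (by omega)
    have hcomm : Commute (ascSum q s m) (s (m + 1)) :=
      commute_ascSum q fun j hj => h.comm j (m + 1) (by omega) (by omega)
    calc descSum q (fun i => s (i + 1)) (m + 1) * ascSum q s (m + 2)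
        = ascSum q s (m + 1) +
            q • (s (m + 1) * (descSum q (fun i => s (i + 1)) m * ascSum q s (m + 1))) +
            q ^ (m + 2) • (ascProd s (m + 2) * descSum q s (m + 1)) := by
          rw [ascSum_succ q s (m + 1), mul_add, mul_smul_comm, ← hconj.eq, descSum_succ, add_mul,
            one_mul, smul_mul_assoc, mul_assoc]
      _ = ascSum q s (m + 1) +
            (q • (ascSum q s m * (s (m + 1) * descSum q s (m + 1))) +
              q ^ (m + 2) • (ascProd s (m + 1) * (s (m + 1) * descSum q s (m + 1)))) := by
          rw [ih (h.mono (m + 1).le_succ), ← mul_assoc (s (m + 1)), ← hcomm.eq, mul_assoc,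
            add_assoc, ← mul_assoc (ascProd s (m + 1)), ascProd]
      _ = ascSum q s (m + 1) * descSum q s (m + 2) := by
          rw [descSum_succ q s (m + 1), mul_add, mul_one, mul_smul_comm, ascSum_succ q s m, add_mul,
            smul_mul_assoc, smul_add, smul_smul, ← pow_succ']

/-- The two factorizations of the symmetrizer along `⟨s₁, …, sₘ⟩` and along `⟨s₀, …, sₘ₋₁⟩`
agree. -/
theorem IsBraid.braidSymmetrizer_shift_mul_ascSum (q : R) {s : ℕ → A} {m : ℕ}
    (h : IsBraid s (m + 1)) :
    braidSymmetrizer q (fun i => s (i + 1)) m * ascSum q s (m + 1) =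
      braidSymmetrizer q s (m + 1) := by
  induction m with
  | zero => simp [braidSymmetrizer, descSum_succ, descSum_zero, ascSum_succ, ascSum_zero, ascProd]
  | succ m ih =>
    rw [braidSymmetrizer, mul_assoc, h.descSum_shift_mul_ascSum q, ← mul_assoc,
      ih (h.mono (m + 1).le_succ), braidSymmetrizer.eq_2 q s (m + 1)]

theorem IsBraid.braidSymmetrizer_mul_cosetSum (α q : R) {z : A} {s : ℕ → A} {m : ℕ}
    (h : IsBraid s (m + 1)) (hz : ∀ i, 1 ≤ i → i ≤ m → Commute (s i) z) :
    braidSymmetrizer q s m * cosetSum α q z s (m + 1) =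
      (1 + (α * q ^ (m + 1)) • (descProd s (m + 1) * z)) * braidSymmetrizer q s (m + 1) := by
  have hconj : SemiconjBy (descProd s (m + 1) * z) (braidSymmetrizer q (fun i => s (i + 1)) m)
      (braidSymmetrizer q s m) :=
    semiconjBy_braidSymmetrizer q fun i hi =>
      (h.semiconjBy_descProd (by omega)).mul_left (hz (i + 1) (by omega) (by omega)).symm
  rw [cosetSum, mul_add, mul_smul_comm, ← mul_assoc (braidSymmetrizer q s m) (_ * z), ← hconj.eq,
    mul_assoc, h.braidSymmetrizer_shift_mul_ascSum q, add_mul, one_mul, smul_mul_assoc,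
    ← braidSymmetrizer]

end Algebra

section Invertibility

variable {𝕜 A : Type*} [NormedField 𝕜] [Ring A] [Algebra 𝕜 A]

/-- The geometric series `∑ⱼ cʲ gʲ` reduces, after factoring out `1 - (c g)ᵏ` with `gᵏ = 1`, to the
invertible scalar `1 - cᵏ`. -/
theorem isUnit_one_sub_smul {g : A} (hg : IsOfFinOrder g) {c : 𝕜} (hc : ‖c‖ < 1) :
    IsUnit (1 - c • g) := by
  obtain ⟨k, hk, hgk⟩ := isOfFinOrder_iff_pow_eq_one.1 hg
  have hck : 1 - c ^ k ≠ 0 := sub_ne_zero.2 fun h => by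
    have hlt : ‖c ^ k‖ < 1 := by simpa only [norm_pow] using pow_lt_one₀ (norm_nonneg c) hc hk.ne'
    simp [← h] at hlt
  have hscalar : 1 - (c • g) ^ k = algebraMap 𝕜 A (1 - c ^ k) := by
    rw [smul_pow, hgk, map_sub, map_one, Algebra.algebraMap_eq_smul_one]
  have hunit : IsUnit (1 - (c • g) ^ k) := hscalar ▸ (IsUnit.mk0 _ hck).map _
  rw [← mul_neg_geom_sum] at hunit
  have hcomm : Commute (1 - c • g) (∑ i ∈ Finset.range k, (c • g) ^ i) :=
    (mul_neg_geom_sum _ _).trans (geom_sum_mul_neg _ _).symm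
  exact (hcomm.isUnit_mul_iff.1 hunit).1

theorem IsBraid.isUnit_descSum {q : 𝕜} (hq : ‖q‖ < 1) {s : ℕ → A} {m : ℕ} (h : IsBraid s m)
    (hs : ∀ g ∈ Submonoid.closure (Set.range s), IsOfFinOrder g) : IsUnit (descSum q s m) := by
  induction m generalizing s with
  | zero => simp only [descSum_zero, isUnit_one]
  | succ m ih =>
    have hmem : ∀ i, s i ∈ Submonoid.closure (Set.range s) := fun i =>
      Submonoid.subset_closure ⟨i, rfl⟩
    have hpow : ∀ k, ‖q ^ (k + 1)‖ < 1 := fun k => by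
      simpa only [norm_pow] using pow_lt_one₀ (norm_nonneg q) hq k.succ_ne_zero
    have hdesc := isUnit_one_sub_smul (hs _ (descProd_mem hmem (m + 1))) (hpow m)
    have hmul := isUnit_one_sub_smul
      (hs _ (mul_mem (hmem m) (descProd_mem hmem (m + 1)))) (hpow (m + 1))
    have hshift : IsUnit (descSum q (fun i => s (i + 1)) m) :=
      ih h.shift fun g hg => hs g <| Submonoid.closure_mono
        (Set.range_comp_subset_range (· + 1) s) hg
    rw [← hdesc.unit.isUnit_mul_units, IsUnit.unit_spec, h.descSum_mul_one_sub q]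
    exact hmul.mul hshift

theorem IsBraid.isUnit_braidSymmetrizer {q : 𝕜} (hq : ‖q‖ < 1) {s : ℕ → A} {m : ℕ}
    (h : IsBraid s m) (hs : ∀ g ∈ Submonoid.closure (Set.range s), IsOfFinOrder g) :
    IsUnit (braidSymmetrizer q s m) := by
  induction m with
  | zero => exact isUnit_one
  | succ m ih => exact (ih (h.mono m.le_succ)).mul (h.isUnit_descSum hq hs)

theorem IsBraid.isUnit_cosetSum {α q : 𝕜} (hα : ‖α‖ < 1) (hq : ‖q‖ < 1) {z : A} {s : ℕ → A}
    {m : ℕ} (h : IsBraid s m) (hz : ∀ i, 1 ≤ i → i < m → Commute (s i) z)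
    (hs : ∀ g ∈ Submonoid.closure (insert z (Set.range s)), IsOfFinOrder g) :
    IsUnit (cosetSum α q z s m) := by
  have hone_add : ∀ k, IsUnit (1 + (α * q ^ k) • (descProd s k * z)) := fun k => by
    have hmem : descProd s k * z ∈ Submonoid.closure (insert z (Set.range s)) :=
      mul_mem (descProd_mem (fun i => Submonoid.subset_closure (.inr ⟨i, rfl⟩)) k)
        (Submonoid.subset_closure (.inl rfl))
    have hnorm : ‖-(α * q ^ k)‖ < 1 := by
      rw [norm_neg, norm_mul, norm_pow]
      exact mul_lt_one_of_nonneg_of_lt_one_left (norm_nonneg _) hα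
        (pow_le_one₀ (norm_nonneg _) hq.le)
    simpa only [neg_smul, sub_neg_eq_add] using isUnit_one_sub_smul (hs _ hmem) hnorm
  cases m with
  | zero => simpa [cosetSum, descSum_zero, ascSum_zero] using hone_add 0
  | succ m =>
    have hs' : ∀ g ∈ Submonoid.closure (Set.range s), IsOfFinOrder g := fun g hg =>
      hs g (Submonoid.closure_mono (Set.subset_insert _ _) hg)
    have hsymm := (h.mono m.le_succ).isUnit_braidSymmetrizer hq hs'
    rw [← hsymm.unit.isUnit_units_mul, IsUnit.unit_spec,
      h.braidSymmetrizer_mul_cosetSum α q fun i hi him => hz i hi (by omega)]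
    exact (hone_add (m + 1)).mul (h.isUnit_braidSymmetrizer hq hs')

end Invertibility

end Braid

/-! ### Coset representatives of `Σ(n)` in `Σ(n + 1)` -/

theorem hyperoctahedral_mul_apply {n : ℕ} (σ τ : hyperoctahedral n) (p : Fin n × ℤˣ) :
    (σ * τ).1 p = σ.1 (τ.1 p) :=
  rfl

theorem hyperoctahedral_ext {n : ℕ} {σ τ : hyperoctahedral n}
    (h : ∀ k, σ.1 (k, 1) = τ.1 (k, 1)) : σ = τ := by
  refine Subtype.ext (Equiv.ext ?_)
  rintro ⟨k, t⟩
  rcases Int.units_eq_one_or t with rfl | rfl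
  · exact h k
  · exact (σ.2 (k, 1)).trans ((congrArg opp (h k)).trans (τ.2 (k, 1)).symm)

theorem gen_zero_apply {n : ℕ} (k : Fin (n + 1)) (t : ℤˣ) :
    (gen 0).1 (k, t) = (k, if k = 0 then -t else t) := by
  rcases Int.units_eq_one_or t with rfl | rfl <;>
    by_cases hk : k = 0 <;> simp [gen, Equiv.swap_apply_def, hk]

theorem gen_succ_apply {n : ℕ} (i : Fin n) (k : Fin (n + 1)) (t : ℤˣ) :
    (gen i.succ).1 (k, t) = (Equiv.swap i.castSucc i.succ k, t) :=
  rfl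

theorem val_swap_castSucc_succ {n : ℕ} (i : Fin n) (k : Fin (n + 1)) :
    (Equiv.swap i.castSucc i.succ k).val =
      if k.val = i.val then i.val + 1 else if k.val = i.val + 1 then i.val else k.val := by
  simp only [Equiv.swap_apply_def, Fin.ext_iff, Fin.val_castSucc, Fin.val_succ]
  split_ifs <;> rfl

/-- The inclusion of the points `±1, …, ±n` into the points `±1, …, ±(n + 1)`. -/
def castSuccPoint (n : ℕ) : Fin n × ℤˣ ↪ Fin (n + 1) × ℤˣ :=
  Fin.castSuccEmb.prodMap (.refl ℤˣ)

theorem last_notMem_range_castSuccPoint {n : ℕ} (t : ℤˣ) :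
    (Fin.last n, t) ∉ Set.range (castSuccPoint n) := by
  rintro ⟨⟨k, s⟩, h⟩
  exact (Fin.castSucc_lt_last k).ne (congrArg Prod.fst h)

theorem viaEmbedding_mem_hyperoctahedral {n : ℕ} (σ : hyperoctahedral n) :
    σ.1.viaEmbedding (castSuccPoint n) ∈ hyperoctahedral (n + 1) := by
  rintro ⟨k, t⟩
  induction k using Fin.lastCases with
  | last =>
    rw [Equiv.Perm.viaEmbedding_apply_of_notMem _ _ _ (last_notMem_range_castSuccPoint t)]
    exact Equiv.Perm.viaEmbedding_apply_of_notMem _ _ _ (last_notMem_range_castSuccPoint (-t))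
  | cast k =>
    have hopp : σ.1.viaEmbedding (castSuccPoint n) (castSuccPoint n (opp (k, t))) =
        opp (σ.1.viaEmbedding (castSuccPoint n) (castSuccPoint n (k, t))) := by
      rw [Equiv.Perm.viaEmbedding_apply, Equiv.Perm.viaEmbedding_apply, σ.2]
      rfl
    exact hopp

/-- The embedding of `Σ(n)` into `Σ(n + 1)` as the stabilizer of the last point. -/
def embed (n : ℕ) : hyperoctahedral n →* hyperoctahedral (n + 1) :=
  ((Equiv.Perm.viaEmbeddingHom (castSuccPoint n)).comp (hyperoctahedral n).subtype).codRestrict _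
    viaEmbedding_mem_hyperoctahedral

theorem embed_last {n : ℕ} (σ : hyperoctahedral n) (t : ℤˣ) :
    (embed n σ).1 (Fin.last n, t) = (Fin.last n, t) :=
  Equiv.Perm.viaEmbedding_apply_of_notMem _ _ _ (last_notMem_range_castSuccPoint t)

theorem embed_castSucc {n : ℕ} (σ : hyperoctahedral n) (i : Fin n) (t : ℤˣ) :
    (embed n σ).1 (i.castSucc, t) = ((σ.1 (i, t)).1.castSucc, (σ.1 (i, t)).2) :=
  Equiv.Perm.viaEmbedding_apply σ.1 (castSuccPoint n) (i, t)

theorem embed_injective (n : ℕ) : Function.Injective (embed n) := fun _ _ h =>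
  Subtype.ext (Equiv.Perm.viaEmbeddingHom_injective _ (congrArg Subtype.val h))

theorem embed_gen {n : ℕ} (i : Fin n) : embed n (gen i) = gen i.castSucc := by
  cases n with
  | zero => exact i.elim0
  | succ n =>
    refine hyperoctahedral_ext fun k => ?_
    cases i using Fin.cases with
    | zero =>
      rw [Fin.castSucc_zero, gen_zero_apply]
      induction k using Fin.lastCases with
      | last => rw [embed_last, if_neg (Fin.last_pos.ne')]
      | cast k => simp only [embed_castSucc, gen_zero_apply, Fin.castSucc_eq_zero_iff]
    | succ i =>
      rw [← Fin.succ_castSucc, gen_succ_apply]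
      induction k using Fin.lastCases with
      | last =>
        rw [embed_last, Equiv.swap_apply_of_ne_of_ne (Fin.castSucc_lt_last _).ne']
        exact (Fin.castSucc_lt_last i.succ).ne'
      | cast k =>
        rw [embed_castSucc, gen_succ_apply, Fin.succ_castSucc,
          ← (Fin.castSucc_injective _).map_swap]

theorem exists_embed_eq {n : ℕ} (ρ : hyperoctahedral (n + 1))
    (h : ρ.1 (Fin.last n, 1) = (Fin.last n, 1)) : ∃ σ, embed n σ = ρ := by
  have hlast : ∀ t, ρ.1 (Fin.last n, t) = (Fin.last n, t) := fun t => by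
    rcases Int.units_eq_one_or t with rfl | rfl
    · exact h
    · exact (ρ.2 (Fin.last n, 1)).trans (congrArg opp h)
  have hrange : ∀ p, ∃ p', castSuccPoint n p' = ρ.1 (castSuccPoint n p) := fun p => by
    obtain ⟨⟨k, t⟩, hkt⟩ : ∃ x, x = ρ.1 (castSuccPoint n p) := ⟨_, rfl⟩
    induction k using Fin.lastCases with
    | last =>
      rw [← hlast, ρ.1.apply_eq_iff_eq] at hkt
      exact absurd ⟨p, hkt.symm⟩ (last_notMem_range_castSuccPoint t)
    | cast k => exact ⟨(k, t), hkt⟩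
  choose f hf using hrange
  have hf_inj : Function.Injective f := fun p p' hp => by
    have := hf p
    rwa [hp, hf p', ρ.1.apply_eq_iff_eq, (castSuccPoint n).apply_eq_iff_eq, eq_comm] at this
  refine ⟨⟨Equiv.ofBijective f (Finite.injective_iff_bijective.1 hf_inj), fun p => ?_⟩,
    hyperoctahedral_ext fun k => ?_⟩
  · refine (castSuccPoint n).injective ((hf (opp p)).trans ?_)
    exact (ρ.2 _).trans (congrArg opp (hf p).symm)
  · induction k using Fin.lastCases with
    | last => rw [embed_last, h]
    | cast k => exact (embed_castSucc _ k 1).trans (hf (k, 1))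

/-- The permutation of `n + 1` positions that moves position `b` to the end and keeps the other
positions in order. -/
def moveToLast {n : ℕ} (b : Fin (n + 1)) : Equiv.Perm (Fin (n + 1)) :=
  (finSuccEquiv' b).trans (finSuccEquiv' (Fin.last n)).symm

theorem val_moveToLast {n : ℕ} (b k : Fin (n + 1)) : (moveToLast b k).val =
    if k.val = b.val then n else if k.val < b.val then k.val else k.val - 1 := by
  rcases eq_or_ne k b with rfl | hk
  · simp [moveToLast]
  · obtain ⟨j, rfl⟩ := Fin.exists_succAbove_eq hk
    have hmove : moveToLast b (b.succAbove j) = j.castSucc := by simp [moveToLast]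
    rw [hmove, Fin.val_castSucc]
    rcases lt_or_ge j.castSucc b with hj | hj
    · have hjb : j.val < b.val := hj
      rw [Fin.succAbove_of_castSucc_lt _ _ hj, Fin.val_castSucc, if_neg hjb.ne, if_pos hjb]
    · have hbj : b.val ≤ j.val := hj
      rw [Fin.succAbove_of_le_castSucc _ _ hj, Fin.val_succ, if_neg (by omega),
        if_neg (by omega), Nat.add_sub_cancel]

/-- The signed permutation of `{±1, …, ±n}` with `k ↦ ε k * e k` on positions. -/
def signedPerm {n : ℕ} (e : Equiv.Perm (Fin n)) (ε : Fin n → ℤˣ) : hyperoctahedral n :=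
  ⟨Equiv.prodShear e fun k => Equiv.mulLeft (ε k), fun p => Prod.ext rfl (mul_neg _ p.2)⟩

/-- The minimal right coset representative of `Σ(n)` in `Σ(n + 1)` that sends the signed point `p`
to the last point; the cosets are parametrized by `p`. -/
def rep {n : ℕ} (p : Fin (n + 1) × ℤˣ) : hyperoctahedral (n + 1) :=
  signedPerm (moveToLast p.1) (Pi.mulSingle p.1 p.2)

theorem rep_apply {n : ℕ} (p : Fin (n + 1) × ℤˣ) (k : Fin (n + 1)) (t : ℤˣ) :
    (rep p).1 (k, t) = (moveToLast p.1 k, (if k = p.1 then p.2 else 1) * t) := by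
  simp only [rep, signedPerm, Equiv.prodShear_apply, Pi.mulSingle_apply, Equiv.coe_mulLeft]

theorem rep_self {n : ℕ} (p : Fin (n + 1) × ℤˣ) : (rep p).1 p = (Fin.last n, 1) := by
  rw [← Prod.mk.eta (p := p), rep_apply]
  exact Prod.ext (Fin.ext (by simp [val_moveToLast])) (by simp)

theorem rep_last_one (n : ℕ) : rep (Fin.last n, 1) = 1 :=
  hyperoctahedral_ext fun k => by
    rw [rep_apply, ite_self, one_mul]
    refine Prod.ext (Fin.ext ?_) rfl
    rw [val_moveToLast, Fin.val_last]
    change _ = k.val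
    split_ifs <;> omega

theorem embed_mul_rep_apply {n : ℕ} (σ : hyperoctahedral n) (p : Fin (n + 1) × ℤˣ) :
    (embed n σ * rep p).1 p = (Fin.last n, 1) := by
  rw [hyperoctahedral_mul_apply, rep_self, embed_last]

theorem embed_mul_rep_bijective (n : ℕ) : Function.Bijective
    fun x : hyperoctahedral n × (Fin (n + 1) × ℤˣ) => embed n x.1 * rep x.2 := by
  constructor
  · rintro ⟨σ, p⟩ ⟨τ, p'⟩ (h : embed n σ * rep p = embed n τ * rep p')
    obtain rfl : p = p' := (embed n σ * rep p).1.injective <|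
      (embed_mul_rep_apply σ p).trans (h ▸ (embed_mul_rep_apply τ p').symm)
    rw [embed_injective n (mul_right_cancel h)]
  · intro ρ
    obtain ⟨p, hp⟩ := ρ.1.surjective (Fin.last n, 1)
    obtain ⟨σ, hσ⟩ := exists_embed_eq (ρ * (rep p)⁻¹) <| by
      rw [hyperoctahedral_mul_apply, ← rep_self p]
      exact ((congrArg ρ.1 ((rep p).1.symm_apply_apply p)).trans hp).trans (rep_self p).symm
    exact ⟨(σ, p), by simp only [hσ, inv_mul_cancel_right]⟩

/-- The factorization of `Σ(n + 1)` over the right cosets of `Σ(n)`. -/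
def cosetEquiv (n : ℕ) :
    hyperoctahedral n × (Fin (n + 1) × ℤˣ) ≃ hyperoctahedral (n + 1) :=
  Equiv.ofBijective _ (embed_mul_rep_bijective n)

theorem cosetEquiv_apply {n : ℕ} (σ : hyperoctahedral n) (p : Fin (n + 1) × ℤˣ) :
    cosetEquiv n (σ, p) = embed n σ * rep p :=
  rfl

theorem rep_zero_mul_gen_zero {n : ℕ} (s : ℤˣ) :
    rep ((0 : Fin (n + 1)), s) * gen 0 = rep (0, -s) :=
  hyperoctahedral_ext fun k => by
    rw [hyperoctahedral_mul_apply, gen_zero_apply, rep_apply, rep_apply]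
    by_cases hk : k = 0 <;> simp [hk]

theorem rep_succ_mul_gen_succ {n : ℕ} (i : Fin n) (s : ℤˣ) :
    rep (i.succ, s) * gen i.succ = rep (i.castSucc, s) :=
  hyperoctahedral_ext fun k => by
    rw [hyperoctahedral_mul_apply, gen_succ_apply, rep_apply, rep_apply]
    refine Prod.ext (Fin.ext ?_) ?_
    · simp only [val_moveToLast, val_swap_castSucc_succ, Fin.val_succ, Fin.val_castSucc]
      split_ifs <;> omega
    · simp only [Equiv.swap_apply_eq_iff, Equiv.swap_apply_right]

theorem rep_castSucc_mul_gen_succ {n : ℕ} (i : Fin n) (s : ℤˣ) :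
    rep (i.castSucc, s) * gen i.succ = rep (i.succ, s) := by
  have hsq : gen i.succ * gen i.succ = 1 := hyperoctahedral_ext fun k => by
    rw [hyperoctahedral_mul_apply, gen_succ_apply, gen_succ_apply, Equiv.swap_apply_self]
    rfl
  rw [← rep_succ_mul_gen_succ, mul_assoc, hsq, mul_one]

theorem rep_mul_gen_zero_of_ne {n : ℕ} {b : Fin (n + 2)} (hb : b ≠ 0) (s : ℤˣ) :
    rep (b, s) * gen 0 = embed (n + 1) (gen 0) * rep (b, s) :=
  hyperoctahedral_ext fun k => by
    have hmove : moveToLast b k = 0 ↔ k = 0 := by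
      simp only [← Fin.val_eq_zero_iff, val_moveToLast]
      split_ifs <;> grind
    rw [embed_gen, Fin.castSucc_zero, hyperoctahedral_mul_apply, hyperoctahedral_mul_apply,
      gen_zero_apply, rep_apply, rep_apply, gen_zero_apply]
    simp only [hmove]
    by_cases hk : k = 0
    · simp only [hk, if_true, hb.symm, if_false, one_mul]
    · simp only [hk, if_false]

theorem rep_mul_gen_succ_of_lt {n : ℕ} {b : Fin (n + 2)} {i : Fin n} (hb : i.castSucc.succ < b)
    (s : ℤˣ) : rep (b, s) * gen i.castSucc.succ = embed (n + 1) (gen i.succ) * rep (b, s) :=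
  hyperoctahedral_ext fun k => by
    have hb' : i.val + 1 < b.val := hb
    rw [embed_gen, ← Fin.succ_castSucc, hyperoctahedral_mul_apply, hyperoctahedral_mul_apply,
      gen_succ_apply, rep_apply, rep_apply, gen_succ_apply]
    refine Prod.ext (Fin.ext ?_) ?_
    · simp only [val_moveToLast, val_swap_castSucc_succ, Fin.val_castSucc]
      split_ifs <;> omega
    · simp only [Equiv.swap_apply_eq_iff, Equiv.swap_apply_of_ne_of_ne
        (hb.trans' i.castSucc.castSucc_lt_succ).ne' hb.ne']

theorem rep_mul_gen_succ_of_gt {n : ℕ} {b : Fin (n + 2)} {i : Fin n} (hb : b < i.succ.castSucc)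
    (s : ℤˣ) : rep (b, s) * gen i.succ.succ = embed (n + 1) (gen i.succ) * rep (b, s) :=
  hyperoctahedral_ext fun k => by
    have hb' : b.val < i.val + 1 := hb
    rw [embed_gen, ← Fin.succ_castSucc, hyperoctahedral_mul_apply, hyperoctahedral_mul_apply,
      gen_succ_apply, rep_apply, rep_apply, gen_succ_apply]
    refine Prod.ext (Fin.ext ?_) ?_
    · simp only [val_moveToLast, val_swap_castSucc_succ, Fin.val_castSucc, Fin.val_succ]
      split_ifs <;> omega
    · simp only [Equiv.swap_apply_eq_iff, Equiv.swap_apply_of_ne_of_ne hb.ne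
        (hb.trans i.succ.castSucc_lt_succ).ne]

/-! ### Lengths -/

/-- The pair `(l₁, l₂)` of a generator. -/
def genLength {n : ℕ} (i : Fin n) : ℕ × ℕ := if i.val = 0 then (1, 0) else (0, 1)

/-- The pair `(l₁, l₂)` of the coset representative `rep p`. -/
def repLength {n : ℕ} (p : Fin (n + 1) × ℤˣ) : ℕ × ℕ :=
  if p.2 = 1 then (0, n - p.1.val) else (1, n + p.1.val)

/-- The pair `(l₁, l₂)`, computed recursively from the factorization over cosets. -/
def biLength : (n : ℕ) → hyperoctahedral n → ℕ × ℕ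
  | 0, _ => 0
  | n + 1, σ => biLength n ((cosetEquiv n).symm σ).1 + repLength ((cosetEquiv n).symm σ).2

theorem genLength_succ {n : ℕ} (i : Fin n) : genLength i.succ = (0, 1) :=
  rfl

theorem repLength_one {n : ℕ} (b : Fin (n + 1)) : repLength (b, 1) = (0, n - b.val) :=
  rfl

theorem repLength_neg_one {n : ℕ} (b : Fin (n + 1)) : repLength (b, -1) = (1, n + b.val) :=
  rfl

theorem repLength_castSucc_one {n : ℕ} (i : Fin n) :
    repLength (i.castSucc, 1) = repLength (i.succ, 1) + genLength i.succ := by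
  rw [repLength_one, repLength_one, genLength_succ, Fin.val_castSucc, Fin.val_succ]
  exact Prod.ext rfl (by change n - i.val = n - (i.val + 1) + 1; omega)

theorem repLength_zero_neg_one {n : ℕ} :
    repLength ((0 : Fin (n + 1)), -1) =
      repLength ((0 : Fin (n + 1)), 1) + genLength (0 : Fin (n + 1)) :=
  rfl

theorem repLength_succ_neg_one {n : ℕ} (i : Fin n) :
    repLength (i.succ, -1) = repLength (i.castSucc, -1) + genLength i.succ :=
  rfl

theorem biLength_embed_mul_rep {n : ℕ} (σ : hyperoctahedral n) (p : Fin (n + 1) × ℤˣ) :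
    biLength (n + 1) (embed n σ * rep p) = biLength n σ + repLength p := by
  rw [biLength, ← cosetEquiv_apply, Equiv.symm_apply_apply]

theorem rep_mul_gen {n : ℕ} (p : Fin (n + 1) × ℤˣ) (i : Fin (n + 1)) :
    (∃ p', rep p * gen i = rep p' ∧ repLength p' ≤ repLength p + genLength i) ∨
      ∃ j : Fin n, genLength j = genLength i ∧ rep p * gen i = embed n (gen j) * rep p := by
  obtain ⟨b, s⟩ := p
  cases i using Fin.cases with
  | zero =>
    rcases eq_or_ne b 0 with rfl | hb
    · refine .inl ⟨_, rep_zero_mul_gen_zero s, ?_⟩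
      rcases Int.units_eq_one_or s with rfl | rfl
      · exact repLength_zero_neg_one.le
      · rw [neg_neg, repLength_zero_neg_one, add_assoc]
        exact le_self_add
    · cases n with
      | zero => exact absurd (Subsingleton.elim (α := Fin 1) b 0) hb
      | succ n => exact .inr ⟨0, rfl, rep_mul_gen_zero_of_ne hb s⟩
  | succ i =>
    rcases eq_or_ne b i.succ with rfl | hsucc
    · refine .inl ⟨_, rep_succ_mul_gen_succ i s, ?_⟩
      rcases Int.units_eq_one_or s with rfl | rfl
      · exact (repLength_castSucc_one i).le
      · rw [repLength_succ_neg_one, add_assoc]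
        exact le_self_add
    rcases eq_or_ne b i.castSucc with rfl | hcast
    · refine .inl ⟨_, rep_castSucc_mul_gen_succ i s, ?_⟩
      rcases Int.units_eq_one_or s with rfl | rfl
      · rw [repLength_castSucc_one, add_assoc]
        exact le_self_add
      · exact (repLength_succ_neg_one i).le
    cases n with
    | zero => exact i.elim0
    | succ n =>
      rcases lt_or_gt_of_ne hcast with hlt | hgt
      · obtain ⟨j, rfl⟩ := Fin.exists_succ_eq.2
          (Fin.castSucc_pos_iff.1 (hlt.trans_le' b.zero_le)).ne'
        exact .inr ⟨j.succ, rfl, rep_mul_gen_succ_of_gt hlt s⟩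
      · have hlt : i.succ < b := lt_of_le_of_ne hgt hsucc.symm
        obtain ⟨j, rfl⟩ := Fin.exists_castSucc_eq.2
          ((Fin.succ_ne_last_iff _).1 (hlt.trans_le b.le_last).ne)
        exact .inr ⟨j.succ, rfl, rep_mul_gen_succ_of_lt hlt s⟩

theorem biLength_mul_gen_le {n : ℕ} (σ : hyperoctahedral n) (i : Fin n) :
    biLength n (σ * gen i) ≤ biLength n σ + genLength i := by
  induction n with
  | zero => exact i.elim0
  | succ n ih =>
    obtain ⟨⟨τ, p⟩, rfl⟩ := (cosetEquiv n).surjective σ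
    rw [cosetEquiv_apply, mul_assoc, biLength_embed_mul_rep]
    rcases rep_mul_gen p i with ⟨p', hp, hlen⟩ | ⟨j, hj, hp⟩
    · rw [hp, biLength_embed_mul_rep, add_assoc]
      gcongr
    · rw [hp, ← mul_assoc, ← map_mul, biLength_embed_mul_rep, ← hj, add_right_comm]
      gcongr
      exact ih τ j

theorem biLength_one (n : ℕ) : biLength n 1 = 0 := by
  induction n with
  | zero => rfl
  | succ n ih =>
    have h := biLength_embed_mul_rep (1 : hyperoctahedral n) (Fin.last n, 1)
    rwa [rep_last_one, map_one, mul_one, ih, repLength_one, Fin.val_last, Nat.sub_self] at h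

theorem biLength_prod_le {n : ℕ} (w : List (Fin n)) :
    biLength n (w.map gen).prod ≤ (w.map genLength).sum := by
  induction w using List.reverseRecOn with
  | nil => exact (biLength_one n).le
  | append_singleton w i ih =>
    simp only [List.map_append, List.prod_append, List.sum_append, List.map_cons, List.map_nil,
      List.prod_singleton, List.sum_singleton]
    exact (biLength_mul_gen_le _ _).trans (by gcongr)

/-- Every signed point is reached from the last one along `n, …, 1, -1, …, -n`, where each step is
a generator. -/
theorem signedPoint_induction {n : ℕ} {P : Fin (n + 1) × ℤˣ → Prop} (last : P (Fin.last n, 1))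
    (down : ∀ i : Fin n, P (i.succ, 1) → P (i.castSucc, 1)) (flip : P (0, 1) → P (0, -1))
    (up : ∀ i : Fin n, P (i.castSucc, -1) → P (i.succ, -1)) (p : Fin (n + 1) × ℤˣ) : P p := by
  have pos : ∀ b, P (b, 1) := fun b => Fin.reverseInduction last down b
  obtain ⟨b, s⟩ := p
  rcases Int.units_eq_one_or s with rfl | rfl
  · exact pos b
  · exact Fin.induction (flip (pos 0)) up b

theorem exists_word_rep {n : ℕ} (p : Fin (n + 1) × ℤˣ) :
    ∃ w : List (Fin (n + 1)), (w.map gen).prod = rep p ∧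
      (w.map genLength).sum = repLength p := by
  induction p using signedPoint_induction with
  | last => exact ⟨[], (rep_last_one n).symm,
      by rw [repLength_one, Fin.val_last, Nat.sub_self]; rfl⟩
  | down i h =>
    obtain ⟨w, hw, hlen⟩ := h
    exact ⟨w ++ [i.succ], by simp [hw, rep_succ_mul_gen_succ],
      by simp [hlen, repLength_castSucc_one]⟩
  | flip h =>
    obtain ⟨w, hw, hlen⟩ := h
    exact ⟨w ++ [0], by simp [hw, rep_zero_mul_gen_zero], by simp [hlen, repLength_zero_neg_one]⟩
  | up i h =>
    obtain ⟨w, hw, hlen⟩ := h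
    exact ⟨w ++ [i.succ], by simp [hw, rep_castSucc_mul_gen_succ],
      by simp [hlen, repLength_succ_neg_one]⟩

theorem exists_word {n : ℕ} (σ : hyperoctahedral n) :
    ∃ w : List (Fin n), (w.map gen).prod = σ ∧ (w.map genLength).sum = biLength n σ := by
  induction n with
  | zero => exact ⟨[], hyperoctahedral_ext fun k => k.elim0, rfl⟩
  | succ n ih =>
    obtain ⟨⟨τ, p⟩, rfl⟩ := (cosetEquiv n).surjective σ
    obtain ⟨w, hw, hwlen⟩ := ih τ
    obtain ⟨v, hv, hvlen⟩ := exists_word_rep p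
    have hembed : gen ∘ Fin.castSucc = embed n ∘ gen := funext fun i => (embed_gen i).symm
    have hlen : genLength ∘ Fin.castSucc = (genLength : Fin n → ℕ × ℕ) := rfl
    refine ⟨w.map Fin.castSucc ++ v, ?_, ?_⟩
    · rw [List.map_append, List.prod_append, hv, List.map_map, hembed, ← List.map_map,
        ← map_list_prod, hw, cosetEquiv_apply]
    · rw [List.map_append, List.sum_append, hvlen, List.map_map, hlen, hwlen, cosetEquiv_apply,
        biLength_embed_mul_rep]

theorem sum_genLength {n : ℕ} (w : List (Fin n)) : (w.map genLength).sum =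
    (w.countP (fun i => i.val = 0), w.countP (fun i => i.val ≠ 0)) := by
  induction w with
  | nil => rfl
  | cons i w ih =>
    rw [List.map_cons, List.sum_cons, ih]
    by_cases hi : i.val = 0 <;> simp [genLength, hi, add_comm]

theorem length_eq_sum_genLength {n : ℕ} (w : List (Fin n)) :
    w.length = (w.map genLength).sum.1 + (w.map genLength).sum.2 := by
  rw [sum_genLength, List.length_eq_countP_add_countP (fun i : Fin n => decide (i.val = 0))]
  simp only [decide_eq_true_eq, ne_eq]

theorem isIrreducibleForm_iff {n : ℕ} {w : List (Fin n)} {σ : hyperoctahedral n} :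
    IsIrreducibleForm w σ ↔ (w.map gen).prod = σ ∧ (w.map genLength).sum = biLength n σ := by
  have hle : ∀ v : List (Fin n), (v.map gen).prod = σ → biLength n σ ≤ (v.map genLength).sum :=
    fun v hv => hv ▸ biLength_prod_le v
  refine and_congr_right fun hw => ⟨fun hmin => ?_, fun hlen v hv => ?_⟩
  · obtain ⟨v, hv, hvlen⟩ := exists_word σ
    have hwv := hmin v hv
    have hw_le := Prod.le_def.1 (hle w hw)
    rw [length_eq_sum_genLength, length_eq_sum_genLength, hvlen] at hwv
    exact Prod.ext (by omega) (by omega)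
  · have hv_le := Prod.le_def.1 (hle v hv)
    rw [length_eq_sum_genLength, length_eq_sum_genLength, hlen]
    omega

theorem length_eq_biLength {n : ℕ} (σ : hyperoctahedral n) : (l₁ σ, l₂ σ) = biLength n σ := by
  obtain ⟨w, hw⟩ := exists_word σ
  have hirr := isIrreducibleForm_iff.2 hw
  have hcount : ∀ v, IsIrreducibleForm v σ →
      (v.countP (fun i => i.val = 0), v.countP (fun i => i.val ≠ 0)) = biLength n σ :=
    fun v hv => (sum_genLength v).symm.trans (isIrreducibleForm_iff.1 hv).2
  have h₁ : {m | ∃ v : List (Fin n), IsIrreducibleForm v σ ∧ m = v.countP (fun i => i.val = 0)} =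
      {(biLength n σ).1} :=
    Set.eq_singleton_iff_unique_mem.2 ⟨⟨w, hirr, congrArg Prod.fst (hcount w hirr).symm⟩, by
      rintro _ ⟨v, hv, rfl⟩
      exact congrArg Prod.fst (hcount v hv)⟩
  have h₂ : {m | ∃ v : List (Fin n), IsIrreducibleForm v σ ∧ m = v.countP (fun i => i.val ≠ 0)} =
      {(biLength n σ).2} :=
    Set.eq_singleton_iff_unique_mem.2 ⟨⟨w, hirr, congrArg Prod.snd (hcount w hirr).symm⟩, by
      rintro _ ⟨v, hv, rfl⟩
      exact congrArg Prod.snd (hcount v hv)⟩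
  rw [l₁, l₂, h₁, h₂, csInf_singleton, csInf_singleton]

/-! ### The symmetrizer in the group algebra of `Σ(n)` -/

/-- The generators `π₁, …, πₙ` of `Σ(n + 1)`, numbered from `0` and continued by `1` so that
they form a sequence. -/
def coxeterSeq (n i : ℕ) : hyperoctahedral (n + 1) :=
  if h : i < n then gen (Fin.succ ⟨i, h⟩) else 1

theorem coxeterSeq_of_lt {n i : ℕ} (h : i < n) : coxeterSeq n i = gen (Fin.succ ⟨i, h⟩) :=
  dif_pos h

theorem embed_coxeterSeq {n i : ℕ} (h : i < n) :
    embed (n + 1) (coxeterSeq n i) = coxeterSeq (n + 1) i := by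
  rw [coxeterSeq_of_lt h, coxeterSeq_of_lt (h.trans n.lt_succ_self), embed_gen]
  rfl

theorem coxeterSeq_apply {n i : ℕ} (h : i < n) (k : Fin (n + 1)) (t : ℤˣ) :
    (coxeterSeq n i).1 (k, t) = (Equiv.swap ⟨i, by omega⟩ ⟨i + 1, by omega⟩ k, t) := by
  rw [coxeterSeq_of_lt h, gen_succ_apply]
  rfl

theorem isBraid_coxeterSeq (n : ℕ) : IsBraid (coxeterSeq n) n where
  comm i j hij hj := hyperoctahedral_ext fun k => by
    have hi : i < n := by omega
    have hcomm := (Equiv.Perm.disjoint_swap_swap (x := (⟨i, by omega⟩ : Fin (n + 1)))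
      (y := ⟨i + 1, by omega⟩) (z := ⟨j, by omega⟩) (t := ⟨j + 1, by omega⟩)
      (by simp; omega)).commute
    simp only [hyperoctahedral_mul_apply, coxeterSeq_apply hi, coxeterSeq_apply hj]
    exact Prod.ext (Equiv.congr_fun hcomm.eq k) rfl
  braid i hi := hyperoctahedral_ext fun k => by
    have hi' : i < n := by omega
    have hxy : (⟨i, by omega⟩ : Fin (n + 1)) ≠ ⟨i + 1, by omega⟩ := by simp
    have hyz : (⟨i + 1, by omega⟩ : Fin (n + 1)) ≠ ⟨i + 2, by omega⟩ := by simp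
    have hxz : (⟨i, by omega⟩ : Fin (n + 1)) ≠ ⟨i + 2, by omega⟩ := by simp
    have hbraid := (Equiv.swap_mul_swap_mul_swap hyz.symm hxz.symm).trans
      ((Equiv.swap_comm _ _).trans (Equiv.swap_mul_swap_mul_swap hxy hxz).symm)
    rw [Equiv.swap_comm (⟨i + 2, _⟩ : Fin (n + 1)),
      Equiv.swap_comm (⟨i + 1, _⟩ : Fin (n + 1)) ⟨i, _⟩] at hbraid
    simp only [hyperoctahedral_mul_apply, coxeterSeq_apply hi, coxeterSeq_apply hi']
    exact Prod.ext (Equiv.congr_fun hbraid k) rfl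

theorem commute_coxeterSeq_gen_zero {n i : ℕ} (hi : 1 ≤ i) (hin : i < n) :
    Commute (coxeterSeq n i) (gen 0) := hyperoctahedral_ext fun k => by
  have hne : ∀ j (hj : j < n + 1), 1 ≤ j → (0 : Fin (n + 1)) ≠ ⟨j, hj⟩ :=
    fun j hj h => (show (0 : Fin (n + 1)) < ⟨j, hj⟩ from h).ne
  have hfix : Equiv.swap (⟨i, by omega⟩ : Fin (n + 1)) ⟨i + 1, by omega⟩ k = 0 ↔ k = 0 := by
    rw [Equiv.swap_apply_eq_iff,
      Equiv.swap_apply_of_ne_of_ne (hne i _ hi) (hne (i + 1) _ i.succ_pos)]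
  simp only [hyperoctahedral_mul_apply, coxeterSeq_apply hin, gen_zero_apply, hfix]

theorem rep_one_eq_descProd {n : ℕ} (b : Fin (n + 1)) :
    rep (b, 1) = descProd (fun i => coxeterSeq n (b + i)) (n - b) := by
  induction b using Fin.reverseInduction with
  | last => rw [rep_last_one, Fin.val_last, Nat.sub_self, descProd]
  | cast b ih =>
    have hsub : n - b.castSucc.val = n - b.succ.val + 1 := by
      rw [Fin.val_castSucc, Fin.val_succ]
      omega
    rw [← rep_succ_mul_gen_succ, ih, hsub, descProd_succ', Nat.add_zero b.castSucc.val,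
      Fin.val_castSucc, coxeterSeq_of_lt b.isLt]
    simp only [Fin.val_succ, Nat.add_assoc, Nat.add_comm 1]

theorem rep_neg_one_eq {n : ℕ} (b : Fin (n + 1)) :
    rep (b, -1) = descProd (coxeterSeq n) n * gen 0 * ascProd (coxeterSeq n) b := by
  induction b using Fin.induction with
  | zero =>
    rw [← rep_zero_mul_gen_zero, rep_one_eq_descProd]
    simp only [Fin.val_zero, Nat.zero_add, Nat.sub_zero, ascProd, mul_one]
  | succ b ih =>
    rw [← rep_castSucc_mul_gen_succ, ih, Fin.val_succ, ascProd, coxeterSeq_of_lt b.isLt,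
      Fin.val_castSucc, ← mul_assoc]

section CommRing

variable {R : Type*} [CommRing R]

/-- The symmetrizer `∑ α^{l₁(σ)} q^{l₂(σ)} σ` in the group algebra of `Σ(n)`. -/
def symElement (α q : R) (n : ℕ) : MonoidAlgebra R (hyperoctahedral n) :=
  ∑ σ : hyperoctahedral n, (α ^ l₁ σ * q ^ l₂ σ) • MonoidAlgebra.of R _ σ

/-- The weighted sum over the minimal right coset representatives of `Σ(n)` in `Σ(n + 1)`, in the
group algebra. -/
def cosetElement (α q : R) (n : ℕ) : MonoidAlgebra R (hyperoctahedral (n + 1)) :=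
  ∑ p : Fin (n + 1) × ℤˣ,
    (α ^ (repLength p).1 * q ^ (repLength p).2) • MonoidAlgebra.of R _ (rep p)

variable (R) in
/-- The homomorphism of group algebras induced by the embedding of `Σ(n)` in `Σ(n + 1)`. -/
def embedAlg (n : ℕ) :
    MonoidAlgebra R (hyperoctahedral n) →ₐ[R] MonoidAlgebra R (hyperoctahedral (n + 1)) :=
  MonoidAlgebra.mapDomainAlgHom R R (embed n)

theorem embedAlg_of {n : ℕ} (σ : hyperoctahedral n) :
    embedAlg R n (MonoidAlgebra.of R _ σ) = MonoidAlgebra.of R _ (embed n σ) := by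
  simp [embedAlg]

theorem symElement_zero (α q : R) : symElement α q 0 = 1 := by
  have hσ : ∀ σ : hyperoctahedral 0, σ = 1 := fun σ => hyperoctahedral_ext fun k => k.elim0
  have hl₁ : l₁ (1 : hyperoctahedral 0) = 0 := congrArg Prod.fst (length_eq_biLength _)
  have hl₂ : l₂ (1 : hyperoctahedral 0) = 0 := congrArg Prod.snd (length_eq_biLength _)
  rw [symElement, Fintype.sum_eq_single 1 fun σ hne => absurd (hσ σ) hne, hl₁, hl₂, pow_zero,
    pow_zero, mul_one, one_smul, map_one]

theorem symElement_succ (α q : R) (n : ℕ) :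
    symElement α q (n + 1) = embedAlg R n (symElement α q n) * cosetElement α q n := by
  have hlength : ∀ (σ : hyperoctahedral n) p,
      (l₁ (embed n σ * rep p), l₂ (embed n σ * rep p)) = (l₁ σ, l₂ σ) + repLength p :=
    fun σ p => by rw [length_eq_biLength, length_eq_biLength, biLength_embed_mul_rep]
  rw [symElement, symElement, cosetElement, map_sum, Finset.sum_mul_sum,
    ← (cosetEquiv n).sum_comp, Fintype.sum_prod_type]
  refine Finset.sum_congr rfl fun σ _ => Finset.sum_congr rfl fun p _ => ?_
  have hl₁ : l₁ (embed n σ * rep p) = l₁ σ + (repLength p).1 := congrArg Prod.fst (hlength σ p)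
  have hl₂ : l₂ (embed n σ * rep p) = l₂ σ + (repLength p).2 := congrArg Prod.snd (hlength σ p)
  rw [cosetEquiv_apply, hl₁, hl₂, map_smul, embedAlg_of, smul_mul_smul_comm, ← map_mul, pow_add,
    pow_add, mul_mul_mul_comm]

theorem cosetElement_eq_cosetSum (α q : R) (n : ℕ) :
    cosetElement α q n = cosetSum α q (MonoidAlgebra.of R _ (gen 0))
      (fun i => MonoidAlgebra.of R _ (coxeterSeq n i)) n := by
  rw [cosetElement, cosetSum, descSum, ascSum, Finset.sum_range, Finset.sum_range, Finset.mul_sum,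
    Finset.smul_sum, Fintype.sum_prod_type, ← Finset.sum_add_distrib]
  refine Finset.sum_congr rfl fun b _ => ?_
  rw [UnitsInt.univ, Finset.sum_pair (by decide), repLength_one, repLength_neg_one,
    rep_one_eq_descProd, rep_neg_one_eq, map_mul, map_mul, map_descProd _ fun _ _ => rfl,
    map_descProd _ fun _ _ => rfl, map_ascProd _ fun _ _ => rfl, pow_zero, one_mul, pow_one,
    mul_smul_comm, smul_smul, pow_add, mul_assoc α]

theorem cosetElement_zero (α q : R) :
    cosetElement α q 0 = 1 + α • MonoidAlgebra.of R _ (rep (Fin.last 0, -1)) := by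
  rw [cosetElement_eq_cosetSum, cosetSum, descSum_zero, ascSum_zero, rep_neg_one_eq, Fin.val_last,
    descProd, descProd, ascProd, pow_zero, mul_one, one_mul, mul_one, one_mul, mul_one]

theorem cosetElement_succ (α q : R) (n : ℕ) :
    cosetElement α q (n + 1) =
      1 + q • (MonoidAlgebra.of R _ (gen (Fin.last (n + 1))) *
          embedAlg R (n + 1) (cosetElement α q n)) +
        (α * q ^ (2 * (n + 1))) • MonoidAlgebra.of R _ (rep (Fin.last (n + 1), -1)) := by
  have hrep : MonoidAlgebra.of R _ (rep (Fin.last (n + 1), -1)) =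
      descProd (fun i => MonoidAlgebra.of R _ (coxeterSeq (n + 1) i)) (n + 1) *
        MonoidAlgebra.of R _ (gen 0) *
        ascProd (fun i => MonoidAlgebra.of R _ (coxeterSeq (n + 1) i)) (n + 1) := by
    rw [rep_neg_one_eq, map_mul, map_mul, map_descProd _ fun _ _ => rfl,
      map_ascProd _ fun _ _ => rfl, Fin.val_last]
  have hembed : embedAlg R (n + 1) (cosetElement α q n) =
      cosetSum α q (MonoidAlgebra.of R _ (gen 0))
        (fun i => MonoidAlgebra.of R _ (coxeterSeq (n + 1) i)) n := by
    rw [cosetElement_eq_cosetSum, map_cosetSum (embedAlg R (n + 1)) α q _ fun i hi =>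
      (embedAlg_of _).trans (congrArg _ (embed_coxeterSeq hi)), embedAlg_of, embed_gen,
      Fin.castSucc_zero]
  rw [cosetElement_eq_cosetSum, cosetSum_succ, hrep, hembed, coxeterSeq_of_lt n.lt_succ_self]
  rfl

end CommRing

section NormedField

variable {𝕜 : Type*} [NormedField 𝕜] {α q : 𝕜}

theorem isUnit_cosetElement (hα : ‖α‖ < 1) (hq : ‖q‖ < 1) (n : ℕ) :
    IsUnit (cosetElement α q n) := by
  rw [cosetElement_eq_cosetSum]
  refine ((isBraid_coxeterSeq n).map (MonoidAlgebra.of 𝕜 _)).isUnit_cosetSum hα hq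
    (fun i hi hin => (commute_coxeterSeq_gen_zero hi hin).map _) fun g hg => ?_
  have hle : Submonoid.closure (insert (MonoidAlgebra.of 𝕜 _ (gen 0))
      (Set.range fun i => MonoidAlgebra.of 𝕜 _ (coxeterSeq n i))) ≤
      MonoidHom.mrange (MonoidAlgebra.of 𝕜 (hyperoctahedral (n + 1))) := by
    rw [Submonoid.closure_le, Set.insert_subset_iff]
    exact ⟨⟨_, rfl⟩, Set.range_subset_iff.2 fun i => ⟨_, rfl⟩⟩
  obtain ⟨σ, rfl⟩ := hle hg
  exact MonoidHom.isOfFinOrder _ (isOfFinOrder_of_finite σ)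

theorem isUnit_symElement (hα : ‖α‖ < 1) (hq : ‖q‖ < 1) (n : ℕ) :
    IsUnit (symElement α q n) := by
  induction n with
  | zero => exact symElement_zero α q ▸ isUnit_one
  | succ n ih =>
    rw [symElement_succ]
    exact (ih.map _).mul (isUnit_cosetElement hα hq n)

end NormedField

/-! ### Contraction of the last tensor factor -/

section Contraction

variable {H : Type*} [NormedAddCommGroup H] [InnerProductSpace ℂ H]

/-- The contraction `x₁ ⊗ ⋯ ⊗ xₙ₊₁ ↦ ⟨x, xₙ₊₁⟩ x₁ ⊗ ⋯ ⊗ xₙ` of the last factor with `x`, the adjoint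
of `appendRight x n` for the undeformed inner products. -/
def contract (x : H) (n : ℕ) : (⨂[ℂ]^(n + 1) H) →ₗ[ℂ] (⨂[ℂ]^n H) :=
  PiTensorProduct.lift (MultilinearMap.uncurryRight (M := fun _ : Fin (n + 1) => H)
    ((LinearMap.smulRightₗ (innerSL ℂ x).toLinearMap).compMultilinearMap
      (PiTensorProduct.tprod ℂ (s := fun _ : Fin n => H))))

theorem contract_tprod (x : H) (n : ℕ) (v : Fin (n + 1) → H) :
    contract x n (PiTensorProduct.tprod ℂ v) =
      inner ℂ x (v (Fin.last n)) • PiTensorProduct.tprod ℂ (Fin.init (α := fun _ => H) v) := by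
  simp [contract]

theorem tensorPower_ext {n : ℕ} {E : Type*} [AddCommMonoid E] [Module ℂ E]
    {f g : (⨂[ℂ]^n H) →ₗ[ℂ] E}
    (h : ∀ v : Fin n → H, f (PiTensorProduct.tprod ℂ v) = g (PiTensorProduct.tprod ℂ v)) : f = g :=
  PiTensorProduct.ext (MultilinearMap.ext h)

theorem contract_appendRight (x y : H) (n : ℕ) (t : ⨂[ℂ]^n H) :
    contract x n (appendRight y n t) = inner ℂ x y • t := by
  suffices hmap : contract x n ∘ₗ appendRight y n = inner ℂ x y • LinearMap.id from
    LinearMap.congr_fun hmap t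
  refine tensorPower_ext fun v => ?_
  rw [LinearMap.comp_apply, appendRight_tprod, contract_tprod, Fin.snoc_last, Fin.init_snoc]
  rfl

theorem innerTensor_appendRight (x : H) (n : ℕ) (s : ⨂[ℂ]^n H) (t : ⨂[ℂ]^(n + 1) H) :
    innerTensor (n + 1) (appendRight x n s) t = innerTensor n s (contract x n t) := by
  induction s using PiTensorProduct.induction_on with
  | smul_tprod r v =>
    have hmap : innerTensor (n + 1) (appendRight x n (PiTensorProduct.tprod ℂ v)) =
        innerTensor n (PiTensorProduct.tprod ℂ v) ∘ₗ contract x n := by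
      refine tensorPower_ext fun w => ?_
      rw [appendRight_tprod, innerTensor_tprod, LinearMap.comp_apply, contract_tprod, map_smul,
        innerTensor_tprod, Fin.prod_univ_castSucc]
      simp [Fin.init, mul_comm]
    rw [map_smul, map_smulₛₗ, map_smulₛₗ, LinearMap.smul_apply, LinearMap.smul_apply, hmap,
      LinearMap.comp_apply]
  | add s s' hs hs' => simp only [map_add, LinearMap.add_apply, hs, hs']

theorem sum_appendRight_contract (V : Submodule ℂ H) [FiniteDimensional ℂ V] {n : ℕ} {y : H}
    (hy : y ∈ V) (t : ⨂[ℂ]^n H) :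
    ∑ i, appendRight (stdOrthonormalBasis ℂ V i : H) n
      (contract (stdOrthonormalBasis ℂ V i : H) n (appendRight y n t)) = appendRight y n t := by
  have hsum : ∑ i, inner ℂ (stdOrthonormalBasis ℂ V i : H) y • (stdOrthonormalBasis ℂ V i : H) =
      y := by
    simpa using congrArg Subtype.val ((stdOrthonormalBasis ℂ V).sum_repr' ⟨y, hy⟩)
  conv_rhs => rw [← hsum]
  simp only [contract_appendRight, map_smul]
  simp only [appendRight, map_sum, map_smul, LinearMap.sum_apply, LinearMap.smul_apply]

theorem exists_sum_appendRight_contract_eq {n : ℕ} (t : ⨂[ℂ]^(n + 1) H) :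
    ∃ V : Submodule ℂ H, FiniteDimensional ℂ V ∧ ∀ (W : Submodule ℂ H) [FiniteDimensional ℂ W],
      V ≤ W → ∑ i, appendRight (stdOrthonormalBasis ℂ W i : H) n
        (contract (stdOrthonormalBasis ℂ W i : H) n t) = t := by
  induction t using PiTensorProduct.induction_on with
  | smul_tprod r v =>
    refine ⟨ℂ ∙ v (Fin.last n), inferInstance, fun W _ hW => ?_⟩
    have happend : r • PiTensorProduct.tprod ℂ v = appendRight (v (Fin.last n)) n
        (r • PiTensorProduct.tprod ℂ (Fin.init (α := fun _ => H) v)) := by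
      rw [map_smul, appendRight_tprod, Fin.snoc_init_self]
    rw [happend]
    exact sum_appendRight_contract W (hW (Submodule.mem_span_singleton_self _)) _
  | add s t hs ht =>
    obtain ⟨V₁, _, hV₁⟩ := hs
    obtain ⟨V₂, _, hV₂⟩ := ht
    refine ⟨V₁ ⊔ V₂, inferInstance, fun W _ hW => ?_⟩
    simp only [map_add, Finset.sum_add_distrib]
    rw [hV₁ W (le_sup_left.trans hW), hV₂ W (le_sup_right.trans hW)]

theorem innerTensor_nondegenerate {n : ℕ} {t : ⨂[ℂ]^n H} (h : ∀ s, innerTensor n s t = 0) :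
    t = 0 := by
  induction n with
  | zero =>
    obtain ⟨c, rfl⟩ :=
      (PiTensorProduct.isEmptyEquiv (R := ℂ) (s := fun _ : Fin 0 => H) (Fin 0)).symm.surjective t
    have hc := h (PiTensorProduct.tprod ℂ isEmptyElim)
    rw [PiTensorProduct.isEmptyEquiv_symm_apply, map_smul, innerTensor_tprod,
      Finset.univ_eq_empty, Finset.prod_empty, smul_eq_mul, mul_one] at hc
    rw [hc, map_zero]
  | succ n ih =>
    obtain ⟨V, _, hV⟩ := exists_sum_appendRight_contract_eq t
    rw [← hV V le_rfl]
    refine Finset.sum_eq_zero fun i _ => ?_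
    have hcontract : contract (stdOrthonormalBasis ℂ V i : H) n t = 0 :=
      ih fun s => by rw [← innerTensor_appendRight, h]
    rw [hcontract, map_zero]

end Contraction

/-! ### Contraction and the action of `Σ(n)` -/

section Action

variable {H : Type*} [NormedAddCommGroup H] [InnerProductSpace ℂ H] (J : H →ₗ[ℂ] H)

theorem embed_inv_castSucc {n : ℕ} (σ : hyperoctahedral n) (i : Fin n) (t : ℤˣ) :
    (embed n σ).1⁻¹ (i.castSucc, t) = ((σ.1⁻¹ (i, t)).1.castSucc, (σ.1⁻¹ (i, t)).2) := by
  have hinv : (embed n σ).1⁻¹ = (embed n σ⁻¹).1 := by rw [map_inv]; rfl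
  rw [hinv, embed_castSucc]
  rfl

theorem embed_inv_last {n : ℕ} (σ : hyperoctahedral n) (t : ℤˣ) :
    (embed n σ).1⁻¹ (Fin.last n, t) = (Fin.last n, t) := by
  rw [Equiv.Perm.inv_eq_iff_eq, embed_last]

theorem contract_act_embed (x : H) {n : ℕ} (σ : hyperoctahedral n) (t : ⨂[ℂ]^(n + 1) H) :
    contract x n (act J (embed n σ) t) = act J σ (contract x n t) := by
  suffices hmap : contract x n ∘ₗ act J (embed n σ) = act J σ ∘ₗ contract x n from
    LinearMap.congr_fun hmap t
  refine tensorPower_ext fun v => ?_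
  rw [LinearMap.comp_apply, LinearMap.comp_apply, act_tprod, contract_tprod, contract_tprod,
    map_smul, act_tprod, embed_inv_last, if_pos rfl]
  congr 2
  funext k
  simp only [Fin.init, embed_inv_castSucc]

theorem act_embed_appendRight (y : H) {n : ℕ} (σ : hyperoctahedral n) (t : ⨂[ℂ]^n H) :
    act J (embed n σ) (appendRight y n t) = appendRight y n (act J σ t) := by
  suffices hmap : act J (embed n σ) ∘ₗ appendRight y n = appendRight y n ∘ₗ act J σ from
    LinearMap.congr_fun hmap t
  refine tensorPower_ext fun v => ?_
  rw [LinearMap.comp_apply, LinearMap.comp_apply, act_tprod, appendRight_tprod, act_tprod,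
    appendRight_tprod]
  congr 1
  funext k
  induction k using Fin.lastCases with
  | last => simp only [embed_inv_last, if_true, Fin.snoc_last]
  | cast k => simp only [embed_inv_castSucc, Fin.snoc_castSucc]

theorem contract_act_gen_last (x y : H) {n : ℕ} (t : ⨂[ℂ]^(n + 1) H) :
    contract x (n + 1) (act J (gen (Fin.last (n + 1))) (appendRight y (n + 1) t)) =
      appendRight y n (contract x n t) := by
  suffices hmap : contract x (n + 1) ∘ₗ act J (gen (Fin.last (n + 1))) ∘ₗ appendRight y (n + 1) =
      appendRight y n ∘ₗ contract x n from LinearMap.congr_fun hmap t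
  have hpred : (⟨(Fin.last (n + 1)).val - 1, by omega⟩ : Fin (n + 2)) = (Fin.last n).castSucc :=
    rfl
  refine tensorPower_ext fun v => ?_
  rw [LinearMap.comp_apply, LinearMap.comp_apply, LinearMap.comp_apply, appendRight_tprod,
    act_gen_pos J _ n.succ_ne_zero, contract_tprod, contract_tprod, map_smul, appendRight_tprod,
    hpred, Equiv.swap_apply_right, Fin.snoc_castSucc]
  congr 2
  funext k
  induction k using Fin.lastCases with
  | last => rw [Fin.init, Equiv.swap_apply_left, Fin.snoc_last, Fin.snoc_last]
  | cast k =>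
    have hk : k.castSucc.castSucc ≠ (Fin.last n).castSucc :=
      (Fin.castSucc_injective _).ne k.castSucc_lt_last.ne
    rw [Fin.init, Equiv.swap_apply_of_ne_of_ne hk (Fin.castSucc_lt_last _).ne, Fin.snoc_castSucc,
      Fin.snoc_castSucc, Fin.init]

theorem rep_last_apply_castSucc {n : ℕ} (s : ℤˣ) (k : Fin n) :
    (rep (Fin.last n, s)).1 (k.castSucc, 1) = (k.castSucc, 1) := by
  have hk := k.isLt
  rw [rep_apply, if_neg k.castSucc_lt_last.ne, mul_one]
  refine Prod.ext (Fin.ext ?_) rfl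
  rw [val_moveToLast, if_neg (by simp; omega), if_pos (by simp)]

theorem contract_act_rep_last (x y : H) {n : ℕ} (t : ⨂[ℂ]^n H) :
    contract x n (act J (rep (Fin.last n, -1)) (appendRight y n t)) = inner ℂ x (J y) • t := by
  suffices hmap : contract x n ∘ₗ act J (rep (Fin.last n, -1)) ∘ₗ appendRight y n =
      inner ℂ x (J y) • LinearMap.id from LinearMap.congr_fun hmap t
  have hlast : (rep (Fin.last n, -1)).1⁻¹ (Fin.last n, 1) = (Fin.last n, -1) := by
    rw [Equiv.Perm.inv_eq_iff_eq, rep_self]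
  have hcast : ∀ k : Fin n, (rep (Fin.last n, -1)).1⁻¹ (k.castSucc, 1) = (k.castSucc, 1) :=
    fun k => by rw [Equiv.Perm.inv_eq_iff_eq, rep_last_apply_castSucc]
  refine tensorPower_ext fun v => ?_
  rw [LinearMap.comp_apply, LinearMap.comp_apply, appendRight_tprod, act_tprod, contract_tprod,
    hlast, if_neg (show (-1 : ℤˣ) ≠ 1 by decide), Fin.snoc_last, LinearMap.smul_apply,
    LinearMap.id_apply]
  congr 2
  funext k
  simp only [Fin.init, hcast, if_true, Fin.snoc_castSucc]

variable {J} (hJ : ∀ x, J (J x) = x)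

/-- The extension of the action of `Σ(n)` on `H^{⊗n}` to the group algebra; `J` has to be an
involution for `act` to be multiplicative. -/
def actAlg (n : ℕ) :
    MonoidAlgebra ℂ (hyperoctahedral n) →ₐ[ℂ] Module.End ℂ (⨂[ℂ]^n H) :=
  MonoidAlgebra.lift ℂ (Module.End ℂ (⨂[ℂ]^n H)) (hyperoctahedral n)
    { toFun := act J
      map_one' := act_one J
      map_mul' := act_mul J hJ }

theorem actAlg_of {n : ℕ} (σ : hyperoctahedral n) :
    actAlg hJ n (MonoidAlgebra.of ℂ _ σ) = act J σ :=
  MonoidAlgebra.lift_of _ _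

theorem symmetrization_eq_actAlg (α q : ℝ) (n : ℕ) :
    symmetrization α q J n = actAlg hJ n (symElement (α : ℂ) q n) := by
  rw [symmetrization, symElement, map_sum]
  exact Finset.sum_congr rfl fun σ _ => by rw [map_smul, actAlg_of]

theorem contract_actAlg_embedAlg (x : H) {n : ℕ} (a : MonoidAlgebra ℂ (hyperoctahedral n))
    (t : ⨂[ℂ]^(n + 1) H) :
    contract x n (actAlg hJ (n + 1) (embedAlg ℂ n a) t) = actAlg hJ n a (contract x n t) := by
  induction a using MonoidAlgebra.induction_on with
  | of σ => rw [embedAlg_of, actAlg_of, actAlg_of, contract_act_embed]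
  | add a b ha hb => simp only [map_add, LinearMap.add_apply, ha, hb]
  | smul c a ha => simp only [map_smul, LinearMap.smul_apply, ha]

theorem actAlg_embedAlg_appendRight (y : H) {n : ℕ} (a : MonoidAlgebra ℂ (hyperoctahedral n))
    (t : ⨂[ℂ]^n H) :
    actAlg hJ (n + 1) (embedAlg ℂ n a) (appendRight y n t) =
      appendRight y n (actAlg hJ n a t) := by
  induction a using MonoidAlgebra.induction_on with
  | of σ => rw [embedAlg_of, actAlg_of, actAlg_of, act_embed_appendRight]
  | add a b ha hb => simp only [map_add, LinearMap.add_apply, ha, hb]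
  | smul c a ha => simp only [map_smul, LinearMap.smul_apply, ha]

theorem contract_symmetrization_succ (α q : ℝ) (x : H) (n : ℕ) (t : ⨂[ℂ]^(n + 1) H) :
    contract x n (symmetrization α q J (n + 1) t) =
      symmetrization α q J n (contract x n (actAlg hJ (n + 1) (cosetElement (α : ℂ) q n) t)) := by
  rw [symmetrization_eq_actAlg hJ, symmetrization_eq_actAlg hJ, symElement_succ, map_mul,
    Module.End.mul_apply, contract_actAlg_embedAlg]

include hJ in
theorem symmetrization_injective {α q : ℝ} (hα : α ∈ Set.Ioo (-1 : ℝ) 1)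
    (hq : q ∈ Set.Ioo (-1 : ℝ) 1) (n : ℕ) : Function.Injective (symmetrization α q J n) := by
  have hnorm : ∀ r ∈ Set.Ioo (-1 : ℝ) 1, ‖(r : ℂ)‖ < 1 := fun r hr => by
    rwa [Complex.norm_real, Real.norm_eq_abs, abs_lt]
  rw [symmetrization_eq_actAlg hJ]
  exact ((Module.End.isUnit_iff _).1
    ((isUnit_symElement (hnorm α hα) (hnorm q hq) n).map (actAlg hJ n))).1

theorem contract_actAlg_cosetElement_zero (α q : ℂ) (x y : H) (t : ⨂[ℂ]^0 H) :
    contract x 0 (actAlg hJ 1 (cosetElement α q 0) (appendRight y 0 t)) =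
      inner ℂ x y • t + (α * inner ℂ x (J y)) • t := by
  rw [cosetElement_zero, map_add, map_one, map_smul, actAlg_of, LinearMap.add_apply,
    LinearMap.smul_apply, map_add, map_smul, contract_act_rep_last, Module.End.one_apply,
    contract_appendRight, smul_smul]

theorem contract_actAlg_cosetElement_succ (α q : ℂ) (x y : H) {n : ℕ} (t : ⨂[ℂ]^(n + 1) H) :
    contract x (n + 1) (actAlg hJ (n + 2) (cosetElement α q (n + 1)) (appendRight y (n + 1) t)) =
      inner ℂ x y • t +
        q • appendRight y n (contract x n (actAlg hJ (n + 1) (cosetElement α q n) t)) +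
        (α * inner ℂ x (J y) * q ^ (2 * (n + 1))) • t := by
  simp only [cosetElement_succ, map_add, map_one, map_smul, map_mul, actAlg_of,
    LinearMap.add_apply, LinearMap.smul_apply, Module.End.one_apply, Module.End.mul_apply,
    actAlg_embedAlg_appendRight, contract_act_gen_last, contract_act_rep_last,
    contract_appendRight, smul_smul, mul_right_comm]

end Action

/-! ### The annihilation operators -/

section Annihilation

variable {H : Type*} [NormedAddCommGroup H] [InnerProductSpace ℂ H] {J : H →ₗ[ℂ] H}

theorem innerFock_zero_right (α q : ℝ) (J : H →ₗ[ℂ] H) (f : Fock H) : innerFock α q J f 0 = 0 :=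
  map_zero _

theorem innerFock_add_right (α q : ℝ) (J : H →ₗ[ℂ] H) (f g h : Fock H) :
    innerFock α q J f (g + h) = innerFock α q J f g + innerFock α q J f h :=
  map_add _ _ _

theorem innerFock_sub_right (α q : ℝ) (J : H →ₗ[ℂ] H) (f g h : Fock H) :
    innerFock α q J f (g - h) = innerFock α q J f g - innerFock α q J f h :=
  map_sub _ _ _

theorem innerFock_lof_right (α q : ℝ) (J : H →ₗ[ℂ] H) (f : Fock H) (n : ℕ) (t : ⨂[ℂ]^n H) :
    innerFock α q J f (DirectSum.lof ℂ ℕ (fun m : ℕ => ⨂[ℂ]^m H) n t) =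
      innerTensor n (f n) (symmetrization α q J n t) := by
  rw [innerFock, DirectSum.toModule_lof]
  rfl

theorem innerFock_lof_left (α q : ℝ) (J : H →ₗ[ℂ] H) (n : ℕ) (t : ⨂[ℂ]^n H) (g : Fock H) :
    innerFock α q J (DirectSum.lof ℂ ℕ (fun m : ℕ => ⨂[ℂ]^m H) n t) g =
      innerTensor n t (symmetrization α q J n (g n)) := by
  induction g using DirectSum.induction_on with
  | zero => rw [innerFock_zero_right, DirectSum.zero_apply, map_zero, map_zero]
  | of m g =>
    rw [← DirectSum.lof_eq_of ℂ, innerFock_lof_right]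
    rcases eq_or_ne m n with rfl | hmn
    · rw [DirectSum.lof_apply, DirectSum.lof_apply]
    · rw [DirectSum.lof_eq_of, DirectSum.lof_eq_of, DirectSum.of_eq_of_ne _ _ _ hmn,
        DirectSum.of_eq_of_ne _ _ _ hmn.symm, map_zero, map_zero, map_zero, LinearMap.zero_apply]
  | add g h hg hh =>
    rw [DirectSum.add_apply, map_add, map_add, ← hg, ← hh, innerFock_add_right]

theorem creation_lof (x : H) (n : ℕ) (t : ⨂[ℂ]^n H) :
    creation x (DirectSum.lof ℂ ℕ (fun m : ℕ => ⨂[ℂ]^m H) n t) =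
      DirectSum.lof ℂ ℕ (fun m : ℕ => ⨂[ℂ]^m H) (n + 1) (appendRight x n t) := by
  rw [creation, DirectSum.toModule_lof]
  rfl

theorem creation_apply_zero (x : H) (f : Fock H) : creation x f 0 = 0 := by
  induction f using DirectSum.induction_on with
  | zero => rw [map_zero, DirectSum.zero_apply]
  | of n f =>
    rw [← DirectSum.lof_eq_of ℂ, creation_lof]
    exact DirectSum.of_eq_of_ne _ _ _ n.succ_ne_zero.symm
  | add f g hf hg => rw [map_add, DirectSum.add_apply, hf, hg, add_zero]

theorem creation_apply_succ (x : H) (f : Fock H) (n : ℕ) :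
    creation x f (n + 1) = appendRight x n (f n) := by
  induction f using DirectSum.induction_on with
  | zero => rw [map_zero, DirectSum.zero_apply, DirectSum.zero_apply, map_zero]
  | of m f =>
    rw [← DirectSum.lof_eq_of ℂ, creation_lof]
    rcases eq_or_ne m n with rfl | hmn
    · rw [DirectSum.lof_apply, DirectSum.lof_apply]
    · rw [DirectSum.lof_eq_of, DirectSum.lof_eq_of,
        DirectSum.of_eq_of_ne _ _ _ (Nat.succ_injective.ne hmn.symm),
        DirectSum.of_eq_of_ne _ _ _ hmn.symm, map_zero]
  | add f g hf hg => rw [map_add, DirectSum.add_apply, hf, hg, DirectSum.add_apply, map_add]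

/-- The annihilation operator `b(x)`: it kills the vacuum, and on `H^{⊗(n+1)}` it lets
`cosetElement α q n` act and then contracts the last factor with `x`. -/
def annihilation (hJ : ∀ x, J (J x) = x) (α q : ℝ) (x : H) : Fock H →ₗ[ℂ] Fock H :=
  DirectSum.toModule ℂ ℕ (Fock H) fun
    | 0 => 0
    | n + 1 => DirectSum.lof ℂ ℕ (fun m : ℕ => ⨂[ℂ]^m H) n ∘ₗ contract x n ∘ₗ
        actAlg hJ (n + 1) (cosetElement (α : ℂ) q n)

theorem annihilation_lof_zero (hJ : ∀ x, J (J x) = x) (α q : ℝ) (x : H) (t : ⨂[ℂ]^0 H) :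
    annihilation hJ α q x (DirectSum.lof ℂ ℕ (fun m : ℕ => ⨂[ℂ]^m H) 0 t) = 0 := by
  rw [annihilation, DirectSum.toModule_lof]
  rfl

theorem annihilation_lof_succ (hJ : ∀ x, J (J x) = x) (α q : ℝ) (x : H) (n : ℕ)
    (t : ⨂[ℂ]^(n + 1) H) :
    annihilation hJ α q x (DirectSum.lof ℂ ℕ (fun m : ℕ => ⨂[ℂ]^m H) (n + 1) t) =
      DirectSum.lof ℂ ℕ (fun m : ℕ => ⨂[ℂ]^m H) n
        (contract x n (actAlg hJ (n + 1) (cosetElement (α : ℂ) q n) t)) := by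
  rw [annihilation, DirectSum.toModule_lof]
  rfl

theorem isAnnihilation_annihilation (hJ : ∀ x, J (J x) = x) (α q : ℝ) (x : H) :
    IsAnnihilation α q J x (annihilation hJ α q x) := by
  intro f g
  induction g using DirectSum.induction_on with
  | zero => rw [map_zero, innerFock_zero_right, innerFock_zero_right]
  | of n g =>
    rw [← DirectSum.lof_eq_of ℂ, innerFock_lof_right]
    cases n with
    | zero =>
      rw [creation_apply_zero, map_zero, LinearMap.zero_apply, annihilation_lof_zero,
        innerFock_zero_right]
    | succ n =>
      rw [creation_apply_succ, innerTensor_appendRight, contract_symmetrization_succ hJ,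
        annihilation_lof_succ, innerFock_lof_right]
  | add g h hg hh => rw [map_add, innerFock_add_right, innerFock_add_right, hg, hh]

theorem innerFock_nondegenerate (hJ : ∀ x, J (J x) = x) {α q : ℝ} (hα : α ∈ Set.Ioo (-1 : ℝ) 1)
    (hq : q ∈ Set.Ioo (-1 : ℝ) 1) {g : Fock H} (h : ∀ f, innerFock α q J f g = 0) : g = 0 := by
  refine DFinsupp.ext fun n => symmetrization_injective hJ hα hq n ?_
  rw [DirectSum.zero_apply, map_zero]
  exact innerTensor_nondegenerate fun t => by rw [← innerFock_lof_left, h]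

theorem IsAnnihilation.eq (hJ : ∀ x, J (J x) = x) {α q : ℝ} (hα : α ∈ Set.Ioo (-1 : ℝ) 1)
    (hq : q ∈ Set.Ioo (-1 : ℝ) 1) {x : H} {b b' : Fock H →ₗ[ℂ] Fock H}
    (hb : IsAnnihilation α q J x b) (hb' : IsAnnihilation α q J x b') : b = b' :=
  LinearMap.ext fun g => sub_eq_zero.1 <| innerFock_nondegenerate hJ hα hq fun f => by
    rw [innerFock_sub_right, ← hb, ← hb', sub_self]

theorem qPowTwoN_lof (q : ℝ) (n : ℕ) (t : ⨂[ℂ]^n H) :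
    qPowTwoN q (DirectSum.lof ℂ ℕ (fun m : ℕ => ⨂[ℂ]^m H) n t) =
      (q : ℂ) ^ (2 * n) • DirectSum.lof ℂ ℕ (fun m : ℕ => ⨂[ℂ]^m H) n t := by
  rw [qPowTwoN, functionOfNumber, DirectSum.lmap_lof, LinearMap.smul_apply, LinearMap.id_apply,
    map_smul]

theorem annihilation_comp_creation (hJ : ∀ x, J (J x) = x) (α q : ℝ) (x y : H) :
    annihilation hJ α q x ∘ₗ creation y - (q : ℂ) • (creation y ∘ₗ annihilation hJ α q x) =
      inner ℂ x y • LinearMap.id + ((α : ℂ) * inner ℂ x (J y)) • qPowTwoN q := by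
  refine DirectSum.linearMap_ext _ fun n => LinearMap.ext fun t => ?_
  simp only [LinearMap.comp_apply, LinearMap.sub_apply, LinearMap.add_apply, LinearMap.smul_apply,
    LinearMap.id_apply, creation_lof, annihilation_lof_succ, qPowTwoN_lof]
  cases n with
  | zero =>
    rw [contract_actAlg_cosetElement_zero, annihilation_lof_zero, map_zero, smul_zero, sub_zero,
      mul_zero, pow_zero, one_smul, map_add, map_smul, map_smul]
  | succ n =>
    rw [contract_actAlg_cosetElement_succ, annihilation_lof_succ, creation_lof, map_add, map_add,
      map_smul, map_smul, map_smul, smul_smul]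
    abel

end Annihilation

end TypeBFock

end

theorem mainTheorem3_general {H : Type*} [NormedAddCommGroup H] [InnerProductSpace ℂ H]
    (J : H →ₗ[ℂ] H) (hJ_inv : ∀ x, J (J x) = x)
    (α q : ℝ) (hα : α ∈ Set.Ioo (-1 : ℝ) 1) (hq : q ∈ Set.Ioo (-1 : ℝ) 1) :
    (∀ x : H, ∃! b : TypeBFock.Fock H →ₗ[ℂ] TypeBFock.Fock H,
      TypeBFock.IsAnnihilation α q J x b) ∧
    ∀ (x y : H) (b : TypeBFock.Fock H →ₗ[ℂ] TypeBFock.Fock H),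
      TypeBFock.IsAnnihilation α q J x b →
        b ∘ₗ TypeBFock.creation y - (q : ℂ) • (TypeBFock.creation y ∘ₗ b) =
          inner ℂ x y • LinearMap.id +
            ((α : ℂ) * inner ℂ x (J y)) • TypeBFock.qPowTwoN q := by
  have hb : ∀ x, TypeBFock.IsAnnihilation α q J x (TypeBFock.annihilation hJ_inv α q x) :=
    TypeBFock.isAnnihilation_annihilation hJ_inv α q
  refine ⟨fun x => ⟨_, hb x, fun b' hb' => hb'.eq hJ_inv hα hq (hb x)⟩, fun x y b' hb' => ?_⟩
  obtain rfl := hb'.eq hJ_inv hα hq (hb x)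
  exact TypeBFock.annihilation_comp_creation hJ_inv α q x y

theorem mainTheorem3 {H : Type*} [NormedAddCommGroup H] [InnerProductSpace ℂ H] [CompleteSpace H]
    (J : H →ₗ[ℂ] H) (hJ_symm : J.IsSymmetric) (hJ_inv : ∀ x, J (J x) = x)
    (α q : ℝ) (hα : α ∈ Set.Ioo (-1 : ℝ) 1) (hq : q ∈ Set.Ioo (-1 : ℝ) 1) :
    (∀ x : H, ∃! b : TypeBFock.Fock H →ₗ[ℂ] TypeBFock.Fock H,
      TypeBFock.IsAnnihilation α q J x b) ∧
    ∀ (x y : H) (b : TypeBFock.Fock H →ₗ[ℂ] TypeBFock.Fock H),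
      TypeBFock.IsAnnihilation α q J x b →
        b ∘ₗ TypeBFock.creation y - (q : ℂ) • (TypeBFock.creation y ∘ₗ b) =
          inner ℂ x y • LinearMap.id +
            ((α : ℂ) * inner ℂ x (J y)) • TypeBFock.qPowTwoN q :=
  mainTheorem3_general J hJ_inv α q hα hq
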